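/- **Proposition (Louise cluster algebras are locally acyclic).** *Conventions.* Quivers are finite and have no loops and no directed 2-cycles. A *seed* in a field $\mathcal F$ of characteristic zero is a quiver $\widetilde{\mathsf Q}$ with some vertices designated as frozen (the others are mutable), together with a bijection $i\mapsto x_i$ from its vertices to a free generating set of the field $\mathcal F$ over $\mathbb Q$; the set $\{x_i\}$ is a *cluster* and its elements are *cluster variables*. The *mutable quiver* $\mathsf Q$ of a seed is the induced subquiver on the mutable vertices. Mutation at a mutable vertex $k$ mutates the quiver in the usual way and replaces $x_k$ by $x_k'$ with $x_kx_k'=\prod_{i\to k}x_i+\prod_{k\to j}x_j$ (products over arrows). The *cluster algebra* $\mathcal A\subset\mathcal F$ of a mutation-equivalence class of seeds is the subring of $\mathcal F$ generated by the cluster variables of all its seeds and the inverses of the frozen variables. Its *exchange type* is the set of mutable quivers of its seeds. *Louise.* The class of Louise quivers is the smallest class of quivers such that: (1) every quiver without arrows is Louise; (2) every mutation of a Louise quiver is Louise; (3) if $\mathsf Q$ has an arrow from $s$ to $t$ that lies on no bi-infinite directed path (a sequence of arrows indexed by $\mathbb Z$, each ending where the next one starts), and the quivers obtained from $\mathsf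 Q$ by deleting $t$, by deleting $s$, and by deleting both are all Louise, then $\mathsf Q$ is Louise. A cluster algebra is *Louise* if its exchange type consists of Louise quivers. *Locally acyclic.* A cluster algebra is *acyclic* if it has a seed whose mutable quiver has no directed cycle. A cluster algebra $\mathcal A$ is *locally acyclic* if there are finitely many elements $z_1,\dots,z_M$, each a product of cluster variables within a single cluster of $\mathcal A$, such that each localization $\mathcal A[z_i^{-1}]\subset\mathcal F$ is an acyclic cluster algebra (namely the cluster algebra of the seed obtained by additionally freezing the variables that occur in $z_i$), and $$\operatorname{Spec}(\mathcal A)=\bigcup_{i=1}^{M}\operatorname{Spec}(\mathcal A[z_i^{-1}]).$$ *Statement.* Every Louise cluster algebra is locally acyclic. -/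

import Mathlib

namespace ClusterTheory

universe u v

/-- A quiver on the vertex set `V` without loops or directed 2-cycles;
`arrows i j` is the number of arrows from `i` to `j`. -/
@[ext]
structure ClusterQuiver (V : Type u) where
  arrows : V → V → ℕ
  no_loops : ∀ i, arrows i i = 0
  no_two_cycles : ∀ i j, arrows i j = 0 ∨ arrows j i = 0

namespace ClusterQuiver

variable {V : Type u}

/-- The induced subquiver on a set of vertices. -/
def induce (Q : ClusterQuiver V) (W : Set V) : ClusterQuiver W where
  arrows i j := Q.arrows i j
  no_loops i := Q.no_loops i
  no_two_cycles i j := Q.no_two_cycles i j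

open scoped Classical in
/-- Quiver mutation at `k`: for every pair of arrows `i → k → j` add an arrow `i → j`, reverse
every arrow incident to `k`, and cancel a maximal set of directed 2-cycles. (The truncated
subtraction on `ℕ` is the cancellation.) -/
noncomputable def mutate (Q : ClusterQuiver V) (k : V) : ClusterQuiver V where
  arrows i j :=
    if i = k ∨ j = k then Q.arrows j i
    else (Q.arrows i j + Q.arrows i k * Q.arrows k j) -
      (Q.arrows j i + Q.arrows j k * Q.arrows k i)
  no_loops i := by
    by_cases h : i = k
    · simp [h, Q.no_loops]
    · simp [h]
  no_two_cycles i j := by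
    by_cases h : i = k ∨ j = k
    · have h' : j = k ∨ i = k := h.symm
      simpa only [if_pos h, if_pos h'] using Q.no_two_cycles j i
    · have h' : ¬ (j = k ∨ i = k) := fun h' => h h'.symm
      simp only [if_neg h, if_neg h']
      omega

/-- The quiver has no arrows. -/
def IsEdgeless (Q : ClusterQuiver V) : Prop := ∀ i j, Q.arrows i j = 0

/-- Some (equivalently, every) arrow from `s` to `t` lies on a bi-infinite directed path, that is,
on a sequence of arrows `p i → p (i + 1)` indexed by `i : ℤ`. -/
def OnBiinfinitePath (Q : ClusterQuiver V) (s t : V) : Prop :=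
  ∃ p : ℤ → V, (∀ i, 0 < Q.arrows (p i) (p (i + 1))) ∧ ∃ i, p i = s ∧ p (i + 1) = t

/-- The quiver has no directed cycle. -/
def IsAcyclic (Q : ClusterQuiver V) : Prop :=
  ∀ i, ¬ Relation.TransGen (fun a b => 0 < Q.arrows a b) i i

/-- Louise quivers: the smallest class of quivers that contains the edgeless quivers, is closed
under mutation, and contains `Q` as soon as `Q` has an arrow `s → t` on no bi-infinite directed
path such that deleting `t`, deleting `s`, and deleting both all give Louise quivers. -/
inductive IsLouise : {V : Type u} → ClusterQuiver V → Prop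
  | edgeless {V : Type u} (Q : ClusterQuiver V) : Q.IsEdgeless → IsLouise Q
  | mutate {V : Type u} (Q : ClusterQuiver V) (k : V) : IsLouise Q → IsLouise (Q.mutate k)
  | step {V : Type u} (Q : ClusterQuiver V) (s t : V) :
      0 < Q.arrows s t → ¬ Q.OnBiinfinitePath s t →
      IsLouise (Q.induce {t}ᶜ) → IsLouise (Q.induce {s}ᶜ) → IsLouise (Q.induce {s, t}ᶜ) →
      IsLouise Q

end ClusterQuiver

/-- A seed in the field `F` of characteristic zero: an ice quiver (a quiver with a set of frozen
vertices), and a labelling of its vertices by a free generating set of the field `F` over `ℚ`. -/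
@[ext]
structure Seed (F : Type v) [Field F] [CharZero F] (V : Type u) where
  quiver : ClusterQuiver V
  frozen : Set V
  x : V → F
  algebraicIndependent : AlgebraicIndependent ℚ x
  adjoin_eq_top : IntermediateField.adjoin ℚ (Set.range x) = ⊤

/-- The localization `A[z⁻¹]` of a subring `A` of a field `F` at `z`, as a subring of `F`. -/
def localizeAt {F : Type v} [Field F] (A : Subring F) (z : F) : Subring F :=
  Subring.closure ((A : Set F) ∪ {z⁻¹})

theorem le_localizeAt {F : Type v} [Field F] (A : Subring F) (z : F) : A ≤ localizeAt A z :=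
  fun _ ha => Subring.subset_closure (Or.inl ha)

namespace Seed

variable {F : Type v} [Field F] [CharZero F] {V : Type u}

/-- The mutable vertices. -/
def mutableVertices (S : Seed F V) : Set V := S.frozenᶜ

/-- The mutable quiver: the induced subquiver on the mutable vertices. -/
def mutableQuiver (S : Seed F V) : ClusterQuiver S.mutableVertices :=
  S.quiver.induce S.mutableVertices

/-- Freezing: the vertices in `W` are designated as frozen as well. -/
def freeze (S : Seed F V) (W : Set V) : Seed F V :=
  { S with frozen := S.frozen ∪ W }

variable [Fintype V]

/-- The right-hand side of the exchange relation at `k`: the product of the variables at the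
sources of the arrows into `k`, plus the product of those at the targets of the arrows out of
`k`, with multiplicity. -/
noncomputable def exchangeRHS (S : Seed F V) (k : V) : F :=
  ∏ i, S.x i ^ S.quiver.arrows i k + ∏ j, S.x j ^ S.quiver.arrows k j

open scoped Classical in
/-- The cluster after mutation at `k`: the variable `x k` is replaced by the `x' k` with
`x k * x' k = exchangeRHS k`. -/
noncomputable def mutateCluster (S : Seed F V) (k : V) : V → F :=
  Function.update S.x k (S.exchangeRHS k / S.x k)

theorem exchangeRHS_ne_zero (S : Seed F V) (k : V) : S.exchangeRHS k ≠ 0 := by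
  intro h
  have h1 : MvPolynomial.aeval S.x
      (∏ i, (MvPolynomial.X i : MvPolynomial V ℚ) ^ S.quiver.arrows i k +
        ∏ j, (MvPolynomial.X j : MvPolynomial V ℚ) ^ S.quiver.arrows k j) = 0 := by
    simpa [exchangeRHS] using h
  have h2 := (injective_iff_map_eq_zero _).1 S.algebraicIndependent _ h1
  have h3 := congrArg (MvPolynomial.eval (fun _ => (1 : ℚ))) h2
  norm_num at h3

theorem adjoin_range_mutateCluster (S : Seed F V) (k : V) :
    IntermediateField.adjoin ℚ (Set.range (S.mutateCluster k)) = ⊤ := by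
  classical
  set K := IntermediateField.adjoin ℚ (Set.range (S.mutateCluster k)) with hK
  have hne : ∀ i, i ≠ k → S.x i ∈ K := fun i hi =>
    IntermediateField.subset_adjoin _ _ ⟨i, by simp [mutateCluster, hi]⟩
  have hk : S.exchangeRHS k / S.x k ∈ K :=
    IntermediateField.subset_adjoin _ _ ⟨k, by simp [mutateCluster]⟩
  have hR : S.exchangeRHS k ∈ K := by
    refine add_mem (prod_mem fun i _ => ?_) (prod_mem fun i _ => ?_)
    all_goals
      by_cases hi : i = k
      · subst hi
        simp [S.quiver.no_loops]
      · exact pow_mem (hne i hi) _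
  have hxk : S.x k ∈ K := by
    have := div_mem hR hk
    rwa [div_div_cancel₀ (S.exchangeRHS_ne_zero k)] at this
  rw [eq_top_iff, ← S.adjoin_eq_top, IntermediateField.adjoin_le_iff]
  rintro _ ⟨i, rfl⟩
  by_cases hi : i = k
  · subst hi
    exact hxk
  · exact hne i hi

theorem algebraicIndependent_mutateCluster (S : Seed F V) (k : V) :
    AlgebraicIndependent ℚ (S.mutateCluster k) := by
  have halg : ∀ y : V → F, IntermediateField.adjoin ℚ (Set.range y) = ⊤ →
      Algebra.IsAlgebraic (Algebra.adjoin ℚ (Set.range y)) F := by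
    intro y hy
    refine ⟨fun a => ?_⟩
    have ha : a ∈ IntermediateField.adjoin ℚ (Set.range y) := hy ▸ IntermediateField.mem_top
    obtain ⟨r, hr, s, hs, rfl⟩ := IntermediateField.mem_adjoin_iff_div.1 ha
    have h1 : IsAlgebraic (Algebra.adjoin ℚ (Set.range y)) r :=
      isAlgebraic_algebraMap (⟨r, hr⟩ : Algebra.adjoin ℚ (Set.range y))
    have h2 : IsAlgebraic (Algebra.adjoin ℚ (Set.range y)) s :=
      isAlgebraic_algebraMap (⟨s, hs⟩ : Algebra.adjoin ℚ (Set.range y))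
    rw [div_eq_mul_inv]
    exact h1.mul h2.inv
  have hb : IsTranscendenceBasis ℚ S.x := by
    have := halg _ S.adjoin_eq_top
    exact isTranscendenceBasis_iff_algebraicIndependent_isAlgebraic.2
      ⟨S.algebraicIndependent, this⟩
  have := halg _ (S.adjoin_range_mutateCluster k)
  exact (Algebra.IsAlgebraic.isTranscendenceBasis_of_lift_le_trdeg_of_finite ℚ (S.mutateCluster k)
    hb.lift_cardinalMk_eq_trdeg.le).1

/-- Mutation of a seed at the vertex `k`. -/
noncomputable def mutate (S : Seed F V) (k : V) : Seed F V where
  quiver := S.quiver.mutate k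
  frozen := S.frozen
  x := S.mutateCluster k
  algebraicIndependent := S.algebraicIndependent_mutateCluster k
  adjoin_eq_top := S.adjoin_range_mutateCluster k

/-- Mutation equivalence: `T` arises from `S` by finitely many mutations at mutable vertices.
(Mutation at a fixed vertex is an involution, so this relation is symmetric.) -/
def MutEquiv (S T : Seed F V) : Prop :=
  Relation.ReflTransGen (fun S₁ S₂ => ∃ k ∈ S₁.mutableVertices, S₂ = S₁.mutate k) S T

/-- The cluster algebra of (the mutation class of) the seed `S`: the subring of `F` generated by
the cluster variables of all seeds mutation-equivalent to `S` and the inverses of the frozen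
variables. -/
def clusterAlgebra (S : Seed F V) : Subring F :=
  Subring.closure ({y | ∃ T, S.MutEquiv T ∧ ∃ i, y = T.x i} ∪ {y | ∃ i ∈ S.frozen, y = (S.x i)⁻¹})

/-- The cluster algebra of `S` is acyclic: it has a seed whose mutable quiver has no directed
cycle. -/
def IsAcyclic (S : Seed F V) : Prop :=
  ∃ T, S.MutEquiv T ∧ T.mutableQuiver.IsAcyclic

/-- The cluster algebra of `S` is Louise: its exchange type (the set of the mutable quivers of all
its seeds) consists of Louise quivers. -/
def IsLouise (S : Seed F V) : Prop :=
  ∀ T, S.MutEquiv T → T.mutableQuiver.IsLouise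

/-- The cluster algebra `A` of `S` is locally acyclic: there are finitely many seeds `T i` of `A`
and sets `W i` of vertices such that, with `z i` the product over `W i` of the cluster variables
of `T i`,
* `A[(z i)⁻¹]` is a cluster algebra, namely the one obtained by freezing the variables that occur
  in `z i`, and that cluster algebra is acyclic;
* `Spec A` is the union of the (images of the) spectra of the rings `A[(z i)⁻¹]`. -/
def IsLocallyAcyclic (S : Seed F V) : Prop :=
  ∃ (M : ℕ) (T : Fin M → Seed F V) (W : Fin M → Finset V),
    (∀ i, S.MutEquiv (T i)) ∧
    (∀ i, ((T i).freeze (W i)).clusterAlgebra =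
        localizeAt S.clusterAlgebra (∏ j ∈ W i, (T i).x j) ∧
      ((T i).freeze (W i)).IsAcyclic) ∧
    ⋃ i, Set.range (PrimeSpectrum.comap (Subring.inclusion
      (le_localizeAt S.clusterAlgebra (∏ j ∈ W i, (T i).x j)))) = Set.univ

end Seed

end ClusterTheory

/-!
The spectrum of a Louise cluster algebra `A` is covered by induction on the construction of the
mutable quiver. If an arrow `s → t` lies on no bi-infinite path, then `x s` and `x t` generate the
unit ideal of `A` (`isCoprime_of_not_path`): a prime ideal containing both would, by the exchange
relations, contain the variables at the ends of a next and of a previous arrow, and so on.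
Freezing `s` or `t` deletes the vertex from the mutable quiver, so the two freezings are covered by
induction; clearing denominators, powers of `x s` and of `x t` lie in the ideal generated by the
required monomials, which is therefore the unit ideal (`isCovered_of_isLouise`). The recursion ends
at edgeless quivers. Hence the pieces of the cover are freezings without any arrows between mutable
vertices, and they are acyclic.

It remains to see that such a freezing has the cluster algebra `A[z⁻¹]`
(`clusterAlgebra_freeze_eq`). Since mutable vertices are not connected, an element that is a
Laurent polynomial in all clusters of the freezing lies in its cluster algebra
(`MutablesEdgeless.mem_clusterAlgebra`), by comparing the coefficients of expansions in `x k` and in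
`x' k` one vertex at a time. That all elements of `A` are such Laurent polynomials is the Laurent
phenomenon.

The Laurent phenomenon (`mutateList_x_mem_laurent`) is proved by induction on the length of a
mutation path `j, k, …` from `S`, following Fomin and Zelevinsky. A cluster variable at its end is
Laurent with respect to the seeds obtained by mutating at `j` and at `j, k, j`, from which shorter
paths lead to it. The denominators of these two expansions, which are Laurent polynomials with
respect to `S`, are coprime, in the form that one is a nonzerodivisor modulo the other
(`RegularMod`), if `j` and `k` are connected by an arrow. If they are not, then a frozen variable is
adjoined to the exchange polynomial at `k`, which makes the denominators coprime, and is set to `1`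
in the resulting expansion.
-/

namespace ClusterTheory

universe u v

/-! ### Mutation of quivers and seeds -/

namespace ClusterQuiver

variable {V : Type u}

theorem mutate_mutate (Q : ClusterQuiver V) (k : V) : (Q.mutate k).mutate k = Q := by
  ext i j
  by_cases h : i = k ∨ j = k
  · have h' : j = k ∨ i = k := h.symm
    simp only [mutate, if_pos h, if_pos h']
  · have h' : ¬ (j = k ∨ i = k) := fun h' => h h'.symm
    simp only [mutate, if_neg h, if_neg h', true_or, or_true, if_true]
    have h1 := Q.no_two_cycles i j
    rw [mul_comm (Q.arrows k i), mul_comm (Q.arrows k j)]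
    generalize Q.arrows i k * Q.arrows k j = p
    generalize Q.arrows j k * Q.arrows k i = q
    omega

theorem mutate_arrows_left (Q : ClusterQuiver V) (k j : V) :
    (Q.mutate k).arrows k j = Q.arrows j k := by
  simp [mutate]

theorem mutate_arrows_right (Q : ClusterQuiver V) (k j : V) :
    (Q.mutate k).arrows j k = Q.arrows k j := by
  simp [mutate]

theorem mutate_arrows_of_ne (Q : ClusterQuiver V) {k i j : V} (hi : i ≠ k) (hj : j ≠ k) :
    (Q.mutate k).arrows i j = (Q.arrows i j + Q.arrows i k * Q.arrows k j) -
      (Q.arrows j i + Q.arrows j k * Q.arrows k i) := by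
  simp [mutate, hi, hj]

/-- The opposite quiver, with all arrows reversed. -/
def op (Q : ClusterQuiver V) : ClusterQuiver V where
  arrows i j := Q.arrows j i
  no_loops i := Q.no_loops i
  no_two_cycles i j := Q.no_two_cycles j i

theorem op_mutate (Q : ClusterQuiver V) (k : V) : Q.op.mutate k = (Q.mutate k).op := by
  ext i j
  by_cases h : i = k ∨ j = k
  · have h' : j = k ∨ i = k := h.symm
    simp only [mutate, op, if_pos h, if_pos h']
  · have h' : ¬ (j = k ∨ i = k) := fun h' => h h'.symm
    simp only [mutate, op, if_neg h, if_neg h']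
    ring_nf

end ClusterQuiver

namespace Seed

variable {F : Type v} [Field F] [CharZero F] {V : Type u}

theorem x_ne_zero (S : Seed F V) (i : V) : S.x i ≠ 0 := S.algebraicIndependent.ne_zero i

variable [Fintype V]

theorem mutate_x_self (S : Seed F V) (k : V) : (S.mutate k).x k = S.exchangeRHS k / S.x k := by
  simp [mutate, mutateCluster]

theorem mutate_x_of_ne (S : Seed F V) {k i : V} (h : i ≠ k) : (S.mutate k).x i = S.x i := by
  simp [mutate, mutateCluster, h]

/-- The exchange relation. -/
theorem x_mul_mutate_x (S : Seed F V) (k : V) :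
    S.x k * (S.mutate k).x k = S.exchangeRHS k := by
  rw [mutate_x_self, mul_div_cancel₀ _ (S.x_ne_zero k)]

/-- The exchange polynomial at `k` does not involve the variable at `k`. -/
theorem exchangeRHS_mutate_self (S : Seed F V) (k : V) :
    (S.mutate k).exchangeRHS k = S.exchangeRHS k := by
  have h : ∀ i, (S.mutate k).x i ^ S.quiver.arrows i k = S.x i ^ S.quiver.arrows i k := by
    intro i
    by_cases hi : i = k
    · subst hi; simp [S.quiver.no_loops]
    · rw [S.mutate_x_of_ne hi]
  have h' : ∀ i, (S.mutate k).x i ^ S.quiver.arrows k i = S.x i ^ S.quiver.arrows k i := by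
    intro i
    by_cases hi : i = k
    · subst hi; simp [S.quiver.no_loops]
    · rw [S.mutate_x_of_ne hi]
  have hq : (S.mutate k).quiver = S.quiver.mutate k := rfl
  simp only [exchangeRHS, hq, ClusterQuiver.mutate_arrows_left, ClusterQuiver.mutate_arrows_right,
    h, h']
  exact add_comm _ _

theorem mutate_mutate (S : Seed F V) (k : V) : (S.mutate k).mutate k = S := by
  refine Seed.ext (S.quiver.mutate_mutate k) rfl ?_
  funext i
  by_cases hi : i = k
  · subst hi
    rw [mutate_x_self, exchangeRHS_mutate_self, mutate_x_self,
      div_div_cancel₀ (S.exchangeRHS_ne_zero i)]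
  · rw [mutate_x_of_ne _ hi, mutate_x_of_ne _ hi]

/-- The seed with the opposite quiver and the same cluster. -/
def op (S : Seed F V) : Seed F V := { S with quiver := S.quiver.op }

theorem op_mutate (S : Seed F V) (k : V) : S.op.mutate k = (S.mutate k).op := by
  have hR : S.op.exchangeRHS k = S.exchangeRHS k := add_comm _ _
  refine Seed.ext (S.quiver.op_mutate k) rfl ?_
  funext i
  change S.op.mutateCluster k i = S.mutateCluster k i
  rw [mutateCluster, hR]
  rfl

theorem MutEquiv.frozen_eq {S T : Seed F V} (h : S.MutEquiv T) : T.frozen = S.frozen := by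
  induction h with
  | refl => rfl
  | tail _ h ih =>
    obtain ⟨k, -, rfl⟩ := h
    exact ih

theorem MutEquiv.x_eq_of_frozen {S T : Seed F V} (h : S.MutEquiv T) {i : V} (hi : i ∈ S.frozen) :
    T.x i = S.x i := by
  induction h with
  | refl => rfl
  | @tail T' _ hT' h ih =>
    obtain ⟨k, hk, rfl⟩ := h
    have : i ≠ k := by
      rintro rfl
      exact hk (by rw [MutEquiv.frozen_eq hT']; exact hi)
    rw [mutate_x_of_ne _ this, ih]

theorem mutEquiv_mutate (S : Seed F V) {k : V} (hk : k ∈ S.mutableVertices) :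
    S.MutEquiv (S.mutate k) :=
  Relation.ReflTransGen.single ⟨k, hk, rfl⟩

theorem MutEquiv.trans {S T U : Seed F V} (h : S.MutEquiv T) (h' : T.MutEquiv U) :
    S.MutEquiv U :=
  Relation.ReflTransGen.trans h h'

theorem MutEquiv.symm {S T : Seed F V} (h : S.MutEquiv T) : T.MutEquiv S := by
  induction h with
  | refl => exact Relation.ReflTransGen.refl
  | @tail T' _ _ h ih =>
    obtain ⟨k, hk, rfl⟩ := h
    refine MutEquiv.trans (Relation.ReflTransGen.single ⟨k, hk, ?_⟩) ih
    exact (T'.mutate_mutate k).symm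

theorem MutEquiv.clusterAlgebra_eq {S T : Seed F V} (h : S.MutEquiv T) :
    T.clusterAlgebra = S.clusterAlgebra := by
  have key : ∀ {S T : Seed F V}, S.MutEquiv T → T.clusterAlgebra ≤ S.clusterAlgebra := by
    intro S T h
    refine Subring.closure_mono (Set.union_subset_union ?_ ?_)
    · rintro _ ⟨U, hU, i, rfl⟩
      exact ⟨U, h.trans hU, i, rfl⟩
    · rintro _ ⟨i, hi, rfl⟩
      rw [h.frozen_eq] at hi
      exact ⟨i, hi, by rw [h.x_eq_of_frozen hi]⟩
  exact le_antisymm (key h) (key h.symm)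

theorem MutEquiv.x_mem {S T : Seed F V} (h : S.MutEquiv T) (i : V) :
    T.x i ∈ S.clusterAlgebra :=
  Subring.subset_closure (Or.inl ⟨T, h, i, rfl⟩)

theorem x_mem (S : Seed F V) (i : V) : S.x i ∈ S.clusterAlgebra :=
  MutEquiv.x_mem Relation.ReflTransGen.refl i

theorem inv_x_mem (S : Seed F V) {i : V} (hi : i ∈ S.frozen) : (S.x i)⁻¹ ∈ S.clusterAlgebra :=
  Subring.subset_closure (Or.inr ⟨i, hi, rfl⟩)

/-- Mutations of a freezing are freezings of mutations at unfrozen vertices. -/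
theorem MutEquiv.exists_of_freeze {S T' : Seed F V} {W : Set V} (h : (S.freeze W).MutEquiv T') :
    ∃ T, S.MutEquiv T ∧ T' = T.freeze W := by
  induction h with
  | refl => exact ⟨S, Relation.ReflTransGen.refl, rfl⟩
  | tail _ h ih =>
    obtain ⟨T, hT, rfl⟩ := ih
    obtain ⟨k, hk, rfl⟩ := h
    exact ⟨T.mutate k, hT.trans (T.mutEquiv_mutate fun h => hk (Or.inl h)), rfl⟩

theorem MutEquiv.exists_of_freeze' {S T' : Seed F V} {W : Set V} (h : (S.freeze W).MutEquiv T') :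
    ∃ T, S.MutEquiv T ∧ T' = T.freeze W ∧ ∀ i ∈ W, T.x i = S.x i := by
  obtain ⟨T, hT, rfl⟩ := h.exists_of_freeze
  exact ⟨T, hT, rfl, fun i hi => h.x_eq_of_frozen (Or.inr hi)⟩

end Seed

/-! ### Laurent expansions in one variable over a subring -/

section OneVariable

variable {F : Type v} [Field F]

open Polynomial

/-- Elements of `B[x, x⁻¹]` are polynomials in `x` over `B` divided by any sufficiently large power
of `x`; the degree of the polynomial is controlled as well. -/
theorem mem_closure_insert_inv (B : Subring F) {x f : F} (hx : x ≠ 0)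
    (hf : f ∈ Subring.closure ((B : Set F) ∪ {x, x⁻¹})) :
    ∃ N₀ : ℕ, ∀ N ≥ N₀, ∃ p : B[X], f * x ^ N = aeval x p ∧ p.natDegree ≤ N + N₀ := by
  suffices h : ∃ (N₀ : ℕ) (p : B[X]), f * x ^ N₀ = aeval x p by
    obtain ⟨N, p, h⟩ := h
    refine ⟨max N p.natDegree, fun n hn => ⟨p * X ^ (n - N), ?_, ?_⟩⟩
    · have hN : N ≤ n := (le_max_left _ _).trans hn
      rw [map_mul, ← h, map_pow, aeval_X, mul_assoc, ← pow_add, Nat.add_sub_cancel' hN]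
    · refine natDegree_mul_le.trans ?_
      have := natDegree_X_pow_le (R := B) (n - N)
      have := le_max_right N p.natDegree
      omega
  induction hf using Subring.closure_induction with
  | mem y hy =>
    rcases hy with hy | rfl | rfl
    · exact ⟨0, C ⟨y, hy⟩, by simp; rfl⟩
    · exact ⟨0, X, by simp⟩
    · exact ⟨1, 1, by simp [hx]⟩
  | zero => exact ⟨0, 0, by simp⟩
  | one => exact ⟨0, 1, by simp⟩
  | add a b _ _ ha hb =>
    obtain ⟨N, p, hp⟩ := ha
    obtain ⟨M, q, hq⟩ := hb
    refine ⟨N + M, p * X ^ M + q * X ^ N, ?_⟩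
    simp only [map_add, map_mul, map_pow, aeval_X, ← hp, ← hq]
    ring
  | neg a _ ha =>
    obtain ⟨N, p, hp⟩ := ha
    exact ⟨N, -p, by rw [map_neg, ← hp, neg_mul]⟩
  | mul a b _ _ ha hb =>
    obtain ⟨N, p, hp⟩ := ha
    obtain ⟨M, q, hq⟩ := hb
    refine ⟨N + M, p * q, ?_⟩
    rw [map_mul, ← hp, ← hq]
    ring

/-- A linear form `α x + β` with `α` a unit is a nonzerodivisor modulo an element `P` of the
coefficient ring: in `(B / P)[x]` its leading coefficient is a unit. -/
theorem exists_eq_mul_of_linear (B : Subring F) {x : F} (hx : Transcendental B x) {P α β f h : F}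
    (hP : P ∈ B) (hα0 : α ≠ 0) (hα' : α⁻¹ ∈ B) (hβ : β ∈ B)
    (hf : f ∈ Subring.closure ((B : Set F) ∪ {x, x⁻¹}))
    (hh : h ∈ Subring.closure ((B : Set F) ∪ {x, x⁻¹}))
    (e : f * (α * x + β) = P * h) :
    ∃ g ∈ Subring.closure ((B : Set F) ∪ {x, x⁻¹}), f = P * g := by
  have hx0 : x ≠ 0 := by
    rintro rfl
    exact hx isAlgebraic_zero
  obtain ⟨N, hN⟩ := mem_closure_insert_inv B hx0 hf
  obtain ⟨M, hM⟩ := mem_closure_insert_inv B hx0 hh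
  obtain ⟨p, hp, -⟩ := hN (max N M) (le_max_left _ _)
  obtain ⟨q, hq, -⟩ := hM (max N M) (le_max_right _ _)
  set n := max N M
  -- after dividing by `α`, the linear form is monic
  have key : p * (X + C ((⟨α⁻¹, hα'⟩ : B) * (⟨β, hβ⟩ : B))) = C ⟨P, hP⟩ * (C ⟨α⁻¹, hα'⟩ * q) := by
    apply transcendental_iff_injective.1 hx
    simp only [map_mul, map_add, aeval_X, aeval_C, ← hp, ← hq]
    change f * x ^ n * (x + α⁻¹ * β) = P * (α⁻¹ * (h * x ^ n))
    field_simp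
    linear_combination e
  have hdvd : C (⟨P, hP⟩ : B) ∣ p := by
    have hmon : (X + C ((⟨α⁻¹, hα'⟩ : B) * (⟨β, hβ⟩ : B)) : B[X]).Monic := monic_X_add_C _
    have hz := congrArg (Polynomial.map (Ideal.Quotient.mk (Ideal.span {(⟨P, hP⟩ : B)}))) key
    have hP0 : Ideal.Quotient.mk (Ideal.span {(⟨P, hP⟩ : B)}) ⟨P, hP⟩ = 0 :=
      Ideal.Quotient.eq_zero_iff_mem.2 (Ideal.mem_span_singleton_self _)
    rw [Polynomial.map_mul, Polynomial.map_mul, map_C, hP0, C_0, zero_mul,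
      (hmon.map _).mul_left_eq_zero_iff] at hz
    rw [C_dvd_iff_dvd_coeff]
    intro i
    rw [← Ideal.mem_span_singleton, ← Ideal.Quotient.eq_zero_iff_mem, ← coeff_map, hz, coeff_zero]
  obtain ⟨r, rfl⟩ := hdvd
  refine ⟨aeval x r * (x⁻¹) ^ n, ?_, ?_⟩
  · refine mul_mem ?_ (pow_mem (Subring.subset_closure (by simp)) _)
    rw [aeval_eq_sum_range]
    refine sum_mem fun i _ => ?_
    rw [Algebra.smul_def]
    refine mul_mem (Subring.subset_closure (Or.inl (r.coeff i).2)) (pow_mem ?_ _)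
    exact Subring.subset_closure (by simp)
  · rw [map_mul, aeval_C] at hp
    change f * x ^ n = P * _ at hp
    rw [inv_pow, ← mul_assoc, ← hp, mul_inv_cancel_right₀ (pow_ne_zero _ hx0)]

/-- If `x x' = P ∈ B`, then a common element of the Laurent polynomial rings `B[x, x⁻¹]` and
`B[x', x'⁻¹]` is a polynomial in `x` and `x'`: compare coefficients of the two expansions, and
use the first for the nonnegative and the second for the negative powers of `x`. -/
theorem mem_closure_of_mem_of_mem (B : Subring F) {x x' P f : F} (hx : Transcendental B x)
    (hP : P ∈ B) (hP0 : P ≠ 0) (hxx' : x * x' = P)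
    (hf : f ∈ Subring.closure ((B : Set F) ∪ {x, x⁻¹}))
    (hf' : f ∈ Subring.closure ((B : Set F) ∪ {x', x'⁻¹})) :
    f ∈ Subring.closure ((B : Set F) ∪ {x, x'}) := by
  have hx0 : x ≠ 0 := by
    rintro rfl
    exact hx isAlgebraic_zero
  have hx'0 : x' ≠ 0 := by
    rintro rfl
    exact hP0 (by rw [← hxx', mul_zero])
  obtain ⟨N, hN⟩ := mem_closure_insert_inv B hx0 hf
  obtain ⟨M, hM⟩ := mem_closure_insert_inv B hx'0 hf'
  obtain ⟨p, hp, hpd⟩ := hN (max N M) (le_max_left _ _)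
  obtain ⟨q, hq, hqd⟩ := hM (max N M) (le_max_right _ _)
  set n := max N M with hn
  have hpd : p.natDegree < 2 * n + 1 := by omega
  have hqd : q.natDegree < 2 * n + 1 := by omega
  set P' : B := ⟨P, hP⟩ with hP'
  have hP'0 : P' ≠ 0 := fun h => hP0 (congrArg Subtype.val h)
  have key : C (P' ^ n) * p =
      ∑ i ∈ Finset.range (2 * n + 1), C (q.coeff i * P' ^ i) * X ^ (2 * n - i) := by
    apply transcendental_iff_injective.1 hx
    rw [map_mul, ← hp, aeval_C, map_sum]
    have h1 : f * x' ^ n * x ^ (2 * n) = f * x ^ n * P ^ n := by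
      rw [← hxx']; ring
    have h2 : (algebraMap B F (P' ^ n)) = P ^ n := rfl
    rw [h2, mul_comm, ← h1, hq, aeval_eq_sum_range' hqd, Finset.sum_mul]
    refine Finset.sum_congr rfl fun i hi => ?_
    have hi : i ≤ 2 * n := by simpa [Nat.lt_succ_iff] using hi
    rw [map_mul, aeval_C, map_pow, aeval_X, Algebra.smul_def, map_mul, map_pow]
    change _ * _ * _ = _ * P ^ i * _
    rw [← hxx', mul_pow]
    nth_rewrite 1 [← Nat.add_sub_cancel' hi]
    ring
  have hcoeff : ∀ m, 1 ≤ m → m ≤ n → p.coeff (n - m) = q.coeff (n + m) * P' ^ m := by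
    intro m hm1 hm
    have h := congrArg (fun r => Polynomial.coeff r (n - m)) key
    simp only [coeff_C_mul, finsetSum_coeff, coeff_X_pow, mul_ite, mul_one, mul_zero] at h
    rw [Finset.sum_eq_single_of_mem (n + m) (by simp; omega)] at h
    · rw [if_pos (by omega)] at h
      apply mul_left_cancel₀ (pow_ne_zero n hP'0)
      rw [h]; ring
    · intro b hb hbm
      rw [if_neg]
      simp at hb
      omega
  have hsum : f = ∑ m ∈ Finset.range n, (q.coeff (n + (m + 1)) : F) * x' ^ (m + 1) +
      ∑ i ∈ Finset.range (n + 1), (p.coeff (n + i) : F) * x ^ i := by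
    have h := hp
    rw [aeval_eq_sum_range' hpd, show 2 * n + 1 = n + (n + 1) by ring, Finset.sum_range_add,
      ← Finset.sum_range_reflect] at h
    apply mul_right_cancel₀ (pow_ne_zero n hx0)
    rw [h, add_mul, Finset.sum_mul, Finset.sum_mul]
    congr 1
    · refine Finset.sum_congr rfl fun m hm => ?_
      have hm : m < n := Finset.mem_range.1 hm
      rw [show n - 1 - m = n - (m + 1) by omega, hcoeff (m + 1) (by omega) (by omega),
        Algebra.smul_def, map_mul, map_pow]
      change _ * P ^ _ * _ = _
      have : x ^ n = x ^ (m + 1) * x ^ (n - (m + 1)) := by rw [← pow_add]; congr 1; omega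
      rw [← hxx', this, mul_pow]
      change (q.coeff (n + (m + 1)) : F) * _ * _ = _
      ring
    · refine Finset.sum_congr rfl fun m hm => ?_
      rw [Algebra.smul_def, pow_add]
      change (p.coeff (n + m) : F) * _ = _
      ring
  rw [hsum]
  refine add_mem (sum_mem fun i _ => ?_) (sum_mem fun i _ => ?_)
  · exact mul_mem (Subring.subset_closure (Or.inl (Subtype.mem _)))
      (pow_mem (Subring.subset_closure (by simp)) _)
  · exact mul_mem (Subring.subset_closure (Or.inl (Subtype.mem _)))
      (pow_mem (Subring.subset_closure (by simp)) _)

end OneVariable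

/-! ### Localizations of subrings and nonzerodivisors modulo an element -/

section Localize

variable {F : Type v} [Field F]

theorem inv_mem_localizeAt (A : Subring F) (z : F) : z⁻¹ ∈ localizeAt A z :=
  Subring.subset_closure (Or.inr rfl)

theorem mem_localizeAt_iff {A : Subring F} {z : F} (hz : z ∈ A) (hz0 : z ≠ 0) {a : F} :
    a ∈ localizeAt A z ↔ ∃ n : ℕ, a * z ^ n ∈ A := by
  constructor
  · intro ha
    induction ha using Subring.closure_induction with
    | mem y hy =>
      rcases hy with hy | rfl
      · exact ⟨0, by simpa using hy⟩
      · exact ⟨1, by simp [hz0, one_mem]⟩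
    | zero => exact ⟨0, by simp [zero_mem]⟩
    | one => exact ⟨0, by simp [one_mem]⟩
    | add a b _ _ ha hb =>
      obtain ⟨n, hn⟩ := ha
      obtain ⟨m, hm⟩ := hb
      refine ⟨n + m, ?_⟩
      have := add_mem (mul_mem hn (pow_mem hz m)) (mul_mem hm (pow_mem hz n))
      convert this using 1
      ring
    | neg a _ ha =>
      obtain ⟨n, hn⟩ := ha
      exact ⟨n, by rw [neg_mul]; exact neg_mem hn⟩
    | mul a b _ _ ha hb =>
      obtain ⟨n, hn⟩ := ha
      obtain ⟨m, hm⟩ := hb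
      refine ⟨n + m, ?_⟩
      have := mul_mem hn hm
      convert this using 1
      ring
  · rintro ⟨n, hn⟩
    have h1 : a = a * z ^ n * (z⁻¹) ^ n := by
      rw [inv_pow, mul_inv_cancel_right₀ (pow_ne_zero _ hz0)]
    rw [h1]
    exact mul_mem (le_localizeAt A z hn) (pow_mem (inv_mem_localizeAt A z) _)

/-- The image of `Spec A[z⁻¹]` in `Spec A` is the basic open set defined by `z`. -/
theorem range_comap_localizeAt (A : Subring F) {z : F} (hz : z ∈ A) (hz0 : z ≠ 0) :
    Set.range (PrimeSpectrum.comap (Subring.inclusion (le_localizeAt A z))) =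
      PrimeSpectrum.basicOpen (⟨z, hz⟩ : A) := by
  let _ : Algebra A (localizeAt A z) := (Subring.inclusion (le_localizeAt A z)).toAlgebra
  have hmap : ∀ a : A, ((algebraMap A (localizeAt A z) a : localizeAt A z) : F) = a :=
    fun _ => rfl
  have : IsLocalization.Away (⟨z, hz⟩ : A) (localizeAt A z) := by
    refine (isLocalization_iff _ _).2 ⟨?_, ?_, ?_⟩
    · rintro ⟨_, n, rfl⟩
      rw [map_pow]
      refine IsUnit.pow _ (IsUnit.of_mul_eq_one ⟨z⁻¹, inv_mem_localizeAt A z⟩ (Subtype.ext ?_))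
      exact mul_inv_cancel₀ hz0
    · intro a
      obtain ⟨n, hn⟩ := (mem_localizeAt_iff hz hz0).1 a.2
      exact ⟨(⟨_, hn⟩, ⟨⟨z, hz⟩ ^ n, n, rfl⟩), Subtype.ext rfl⟩
    · intro a b hab
      exact ⟨1, by rw [Subtype.ext (show (a : F) = b by rw [← hmap, hab, hmap])]⟩
  exact PrimeSpectrum.localization_away_comap_range (localizeAt A z) (⟨z, hz⟩ : A)

/-- `c` is a unit of the subring `B`. -/
def IsUnitOf (B : Subring F) (c : F) : Prop := c ≠ 0 ∧ c ∈ B ∧ c⁻¹ ∈ B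

namespace IsUnitOf

variable {B B' : Subring F} {c d : F}

theorem mul (hc : IsUnitOf B c) (hd : IsUnitOf B d) : IsUnitOf B (c * d) :=
  ⟨mul_ne_zero hc.1 hd.1, mul_mem hc.2.1 hd.2.1, by rw [mul_inv]; exact mul_mem hc.2.2 hd.2.2⟩

theorem inv (hc : IsUnitOf B c) : IsUnitOf B c⁻¹ :=
  ⟨inv_ne_zero hc.1, hc.2.2, by rw [inv_inv]; exact hc.2.1⟩

theorem div (hc : IsUnitOf B c) (hd : IsUnitOf B d) : IsUnitOf B (c / d) := by
  rw [div_eq_mul_inv]; exact hc.mul hd.inv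

theorem pow (hc : IsUnitOf B c) (n : ℕ) : IsUnitOf B (c ^ n) :=
  ⟨pow_ne_zero _ hc.1, pow_mem hc.2.1 _, by rw [← inv_pow]; exact pow_mem hc.2.2 _⟩

theorem mono (hc : IsUnitOf B c) (h : B ≤ B') : IsUnitOf B' c := ⟨hc.1, h hc.2.1, h hc.2.2⟩

theorem prod {ι : Type*} {s : Finset ι} {c : ι → F} (h : ∀ i ∈ s, IsUnitOf B (c i)) :
    IsUnitOf B (∏ i ∈ s, c i) :=
  ⟨Finset.prod_ne_zero_iff.2 fun i hi => (h i hi).1, prod_mem fun i hi => (h i hi).2.1, by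
    rw [← Finset.prod_inv_distrib]; exact prod_mem fun i hi => (h i hi).2.2⟩

end IsUnitOf

/-- `z` is a nonzerodivisor modulo the principal ideal generated by `u` in the subring `L`. -/
def RegularMod (L : Subring F) (u z : F) : Prop :=
  ∀ f ∈ L, ∀ h ∈ L, f * z = u * h → ∃ g ∈ L, f = u * g

namespace RegularMod

variable {L : Subring F} {u z w c d : F}

theorem mul (hz : z ∈ L) (h : RegularMod L u z) (h' : RegularMod L u w) :
    RegularMod L u (z * w) := by
  intro f hf g hg e
  obtain ⟨g', hg', e'⟩ := h' (f * z) (mul_mem hf hz) g hg (by rw [← e]; ring)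
  exact h f hf g' hg' e'

theorem pow_right (hz : z ∈ L) (h : RegularMod L u z) (n : ℕ) : RegularMod L u (z ^ n) := by
  induction n with
  | zero => exact fun f _ g hg e => ⟨g, hg, by simpa using e⟩
  | succ n ih => rw [pow_succ]; exact ih.mul (pow_mem hz n) h

theorem pow_left (hu : u ≠ 0) (h : RegularMod L u z) (huL : u ∈ L) (n : ℕ) :
    RegularMod L (u ^ n) z := by
  induction n with
  | zero => exact fun f hf g hg e => ⟨f, hf, by simp⟩
  | succ n ih =>
    intro f hf g hg e
    obtain ⟨f', hf', rfl⟩ := h f hf (u ^ n * g) (mul_mem (pow_mem huL n) hg) (by rw [e]; ring)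
    obtain ⟨f'', hf'', rfl⟩ := ih f' hf' g hg (mul_left_cancel₀ hu (by rw [← mul_assoc, e]; ring))
    exact ⟨f'', hf'', by ring⟩

theorem add_mul (hd : d ∈ L) (h : RegularMod L u z) : RegularMod L u (z + u * d) := by
  intro f hf g hg e
  exact h f hf (g - f * d) (sub_mem hg (mul_mem hf hd)) (by linear_combination e)

theorem unit_mul (hc : IsUnitOf L c) (h : RegularMod L u z) : RegularMod L u (c * z) := by
  intro f hf g hg e
  refine h f hf (g * c⁻¹) (mul_mem hg hc.2.2) ?_
  have := hc.1
  field_simp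
  linear_combination e

theorem of_unit (hc : IsUnitOf L c) : RegularMod L u c := by
  intro f _ g hg e
  refine ⟨g * c⁻¹, mul_mem hg hc.2.2, ?_⟩
  have := hc.1
  field_simp
  exact e

theorem modulus_unit (hc : IsUnitOf L c) (h : RegularMod L u z) : RegularMod L (u * c) z := by
  intro f hf g hg e
  obtain ⟨g', hg', e'⟩ := h f hf (c * g) (mul_mem hc.2.1 hg) (by rw [e]; ring)
  refine ⟨g' * c⁻¹, mul_mem hg' hc.2.2, ?_⟩
  have := hc.1
  rw [e']
  field_simp

/-- If `z` is regular modulo `u`, then `L[u⁻¹] ∩ L[z⁻¹] = L`. -/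
theorem mem_of_mem_localizeAt (hu : u ∈ L) (hu0 : u ≠ 0) (hz : z ∈ L) (hz0 : z ≠ 0)
    (h : RegularMod L u z) {x : F} (hxu : x ∈ localizeAt L u) (hxz : x ∈ localizeAt L z) :
    x ∈ L := by
  obtain ⟨n, hn⟩ := (mem_localizeAt_iff hu hu0).1 hxu
  obtain ⟨m, hm⟩ := (mem_localizeAt_iff hz hz0).1 hxz
  obtain ⟨g, hg, e⟩ := (h.pow_right hz m).pow_left hu0 hu n
    (x * u ^ n) hn (x * z ^ m) hm (by ring)
  rw [mul_comm] at e
  rwa [mul_left_cancel₀ (pow_ne_zero n hu0) e]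

end RegularMod

end Localize

/-! ### Laurent rings of seeds -/

namespace Seed

variable {F : Type v} [Field F] [CharZero F] {V : Type u}

/-- The ring of Laurent polynomials over `ℤ` in the cluster variables of `S` at the vertices in
`W`, as a subring of the ambient field. -/
def laurent (S : Seed F V) (W : Set V) : Subring F :=
  Subring.closure (S.x '' W ∪ (fun i => (S.x i)⁻¹) '' W)

theorem laurent_mono (S : Seed F V) {W W' : Set V} (h : W ⊆ W') : S.laurent W ≤ S.laurent W' :=
  Subring.closure_mono (Set.union_subset_union (Set.image_mono h) (Set.image_mono h))

theorem isUnitOf_laurent (S : Seed F V) {W : Set V} {i : V} (hi : i ∈ W) :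
    IsUnitOf (S.laurent W) (S.x i) :=
  ⟨S.x_ne_zero i, Subring.subset_closure (Or.inl ⟨i, hi, rfl⟩),
    Subring.subset_closure (Or.inr ⟨i, hi, rfl⟩)⟩

theorem laurent_le_iff (S : Seed F V) {W : Set V} {B : Subring F} :
    S.laurent W ≤ B ↔ ∀ i ∈ W, S.x i ∈ B ∧ (S.x i)⁻¹ ∈ B := by
  rw [laurent, Subring.closure_le, Set.union_subset_iff, Set.image_subset_iff,
    Set.image_subset_iff]
  exact ⟨fun h i hi => ⟨h.1 hi, h.2 hi⟩, fun h => ⟨fun i hi => (h i hi).1, fun i hi => (h i hi).2⟩⟩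

theorem laurent_le_closure (S : Seed F V) (i : V) :
    S.laurent Set.univ ≤
      Subring.closure ((S.laurent {i}ᶜ : Set F) ∪ {S.x i, (S.x i)⁻¹}) := by
  refine S.laurent_le_iff.2 fun l _ => ?_
  by_cases hl : l = i
  · subst hl
    exact ⟨Subring.subset_closure (by simp), Subring.subset_closure (by simp)⟩
  · have := S.isUnitOf_laurent (W := {i}ᶜ) hl
    exact ⟨Subring.subset_closure (Or.inl this.2.1), Subring.subset_closure (Or.inl this.2.2)⟩

theorem closure_le_laurent (S : Seed F V) (i : V) :
    Subring.closure ((S.laurent {i}ᶜ : Set F) ∪ {S.x i, (S.x i)⁻¹}) ≤ S.laurent Set.univ := by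
  refine Subring.closure_le.2 (Set.union_subset (S.laurent_mono (Set.subset_univ _)) ?_)
  have := S.isUnitOf_laurent (Set.mem_univ i)
  rintro _ (rfl | rfl)
  exacts [this.2.1, this.2.2]

/-- A cluster variable is transcendental over any subring of the field generated by the other
variables of its cluster. -/
theorem transcendental (S : Seed F V) (i : V) {B : Subring F}
    (hB : ∀ b ∈ B, b ∈ IntermediateField.adjoin ℚ (S.x '' {i}ᶜ)) : Transcendental B (S.x i) := by
  have h1 := S.algebraicIndependent.transcendental_adjoin (s := {i}ᶜ) (i := i) (by simp)
  open scoped IntermediateField.algebraAdjoinAdjoin in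
  have h2 : Transcendental (IntermediateField.adjoin ℚ (S.x '' {i}ᶜ)) (S.x i) := fun h =>
    h1 ((IsFractionRing.isAlgebraic_iff (Algebra.adjoin ℚ (S.x '' {i}ᶜ))
      (IntermediateField.adjoin ℚ (S.x '' {i}ᶜ)) F).2 h)
  let φ : B →+* IntermediateField.adjoin ℚ (S.x '' {i}ᶜ) :=
    { toFun b := ⟨b, hB b b.2⟩, map_one' := rfl, map_mul' _ _ := rfl, map_zero' := rfl,
      map_add' _ _ := rfl }
  intro h
  obtain ⟨p, hp, hp'⟩ := h
  refine h2 ⟨p.map φ, ?_, ?_⟩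
  · rw [Ne, Polynomial.map_eq_zero_iff]
    · exact hp
    · intro a b hab
      exact Subtype.ext (show (φ a : F) = φ b by rw [hab])
  · rw [← hp', Polynomial.aeval_def, Polynomial.eval₂_map]
    rfl

theorem mem_adjoin_of_mem_laurent (S : Seed F V) {W W' : Set V} (h : W ⊆ W') {b : F}
    (hb : b ∈ S.laurent W) : b ∈ IntermediateField.adjoin ℚ (S.x '' W') := by
  refine (S.laurent_le_iff (B := (IntermediateField.adjoin ℚ (S.x '' W')).toSubfield.toSubring)).2
    (fun i hi => ?_) hb
  have : S.x i ∈ IntermediateField.adjoin ℚ (S.x '' W') :=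
    IntermediateField.subset_adjoin _ _ ⟨i, h hi, rfl⟩
  exact ⟨this, IntermediateField.inv_mem _ this⟩

/-- A linear form in `x i` whose leading coefficient is a unit is regular modulo every element not
involving `x i`. -/
theorem regularMod_linear (S : Seed F V) (i : V) {P α β : F} (hP : P ∈ S.laurent {i}ᶜ)
    (hα : IsUnitOf (S.laurent {i}ᶜ) α) (hβ : β ∈ S.laurent {i}ᶜ) :
    RegularMod (S.laurent Set.univ) P (α * S.x i + β) := by
  intro f hf h hh e
  have hx := S.transcendental i fun b hb => S.mem_adjoin_of_mem_laurent subset_rfl hb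
  obtain ⟨g, hg, e'⟩ := exists_eq_mul_of_linear (S.laurent {i}ᶜ) hx hP hα.1 hα.2.2 hβ
    (S.laurent_le_closure i hf) (S.laurent_le_closure i hh) e
  exact ⟨g, S.closure_le_laurent i hg, e'⟩

variable [Fintype V]

theorem exchangeRHS_mem_laurent (S : Seed F V) (k : V) {W : Set V}
    (h : ∀ i ∉ W, S.quiver.arrows i k = 0 ∧ S.quiver.arrows k i = 0) :
    S.exchangeRHS k ∈ S.laurent W := by
  refine add_mem (prod_mem fun i _ => ?_) (prod_mem fun i _ => ?_)
  all_goals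
    by_cases hi : i ∈ W
    · exact pow_mem (S.isUnitOf_laurent hi).2.1 _
    · simp [h i hi, one_mem]

theorem mutate_x_mem_laurent (S : Seed F V) (k : V) :
    (S.mutate k).x k ∈ S.laurent Set.univ := by
  rw [mutate_x_self, div_eq_mul_inv]
  exact mul_mem (S.exchangeRHS_mem_laurent k fun i hi => absurd (Set.mem_univ i) hi)
    (S.isUnitOf_laurent (Set.mem_univ k)).2.2

/-- Mutation at `j` does not change the exchange polynomial at a vertex `k` not connected to
`j`. -/
theorem exchangeRHS_mutate_of_not_adj (S : Seed F V) {j k : V} (hjk : k ≠ j)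
    (h : S.quiver.arrows j k = 0) (h' : S.quiver.arrows k j = 0) :
    (S.mutate j).exchangeRHS k = S.exchangeRHS k := by
  have hq : (S.mutate j).quiver = S.quiver.mutate j := rfl
  unfold exchangeRHS
  congr 1 <;> refine Finset.prod_congr rfl fun i _ => ?_ <;> by_cases hi : i = j
  · subst hi
    rw [hq, ClusterQuiver.mutate_arrows_left, h, h', pow_zero, pow_zero]
  · rw [mutate_x_of_ne _ hi, hq, ClusterQuiver.mutate_arrows_of_ne _ hi hjk, h, h']
    have := S.quiver.no_two_cycles i k
    congr 1
    simp only [mul_zero, zero_mul]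
    omega
  · subst hi
    rw [hq, ClusterQuiver.mutate_arrows_right, h, h', pow_zero, pow_zero]
  · rw [mutate_x_of_ne _ hi, hq, ClusterQuiver.mutate_arrows_of_ne _ hjk hi, h, h']
    have := S.quiver.no_two_cycles i k
    congr 1
    simp only [mul_zero, zero_mul]
    omega

/-- If `x` is Laurent with respect to the seeds `μ_j S` and `μ_j μ_k μ_j S`, and if the two new
variables of the latter are regular modulo the new variable of `μ_j S`, then `x` is Laurent with
respect to `S`. -/
theorem mem_laurent_of_regularMod (S : Seed F V) {j k : V} {x : F} (hjk : j ≠ k)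
    (hw : (((S.mutate j).mutate k).mutate j).x j ∈ S.laurent Set.univ)
    (hz : ((S.mutate j).mutate k).x k ∈ S.laurent Set.univ)
    (hwr : RegularMod (S.laurent Set.univ) ((S.mutate j).x j)
      ((((S.mutate j).mutate k).mutate j).x j))
    (hzr : RegularMod (S.laurent Set.univ) ((S.mutate j).x j) (((S.mutate j).mutate k).x k))
    (hx1 : x ∈ (S.mutate j).laurent Set.univ)
    (hx3 : x ∈ (((S.mutate j).mutate k).mutate j).laurent Set.univ) :
    x ∈ S.laurent Set.univ := by
  set S1 := S.mutate j with hS1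
  set S2 := S1.mutate k with hS2
  set S3 := S2.mutate j with hS3
  have hz3 : S3.x k = S2.x k := mutate_x_of_ne _ hjk.symm
  have hu := S.mutate_x_mem_laurent j
  have hzw : S2.x k * S3.x j ≠ 0 := mul_ne_zero (S2.x_ne_zero k) (S3.x_ne_zero j)
  refine (hzr.mul hz hwr).mem_of_mem_localizeAt hu (S1.x_ne_zero j) (mul_mem hz hw) hzw ?_ ?_
  · refine S1.laurent_le_iff.2 (fun i _ => ?_) hx1
    by_cases hi : i = j
    · subst hi
      exact ⟨le_localizeAt _ _ hu, inv_mem_localizeAt _ _⟩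
    · rw [hS1, mutate_x_of_ne _ hi]
      have := S.isUnitOf_laurent (Set.mem_univ i)
      exact ⟨le_localizeAt _ _ this.2.1, le_localizeAt _ _ this.2.2⟩
  · refine S3.laurent_le_iff.2 (fun i _ => ?_) hx3
    have hinv : (S2.x k * S3.x j)⁻¹ ∈ localizeAt (S.laurent Set.univ) (S2.x k * S3.x j) :=
      inv_mem_localizeAt _ _
    by_cases hi : i = j
    · subst hi
      refine ⟨le_localizeAt _ _ hw, ?_⟩
      have : (S3.x i)⁻¹ = (S2.x k * S3.x i)⁻¹ * S2.x k := by
        rw [mul_inv_rev, inv_mul_cancel_right₀ (S2.x_ne_zero k)]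
      rw [this]
      exact mul_mem hinv (le_localizeAt _ _ hz)
    by_cases hi' : i = k
    · subst hi'
      rw [hz3]
      refine ⟨le_localizeAt _ _ hz, ?_⟩
      have : (S2.x i)⁻¹ = (S2.x i * S3.x j)⁻¹ * S3.x j := by
        rw [mul_inv, inv_mul_cancel_right₀ (S3.x_ne_zero j)]
      rw [this]
      exact mul_mem hinv (le_localizeAt _ _ hw)
    · rw [hS3, mutate_x_of_ne _ hi, hS2, mutate_x_of_ne _ hi', hS1, mutate_x_of_ne _ hi]
      have := S.isUnitOf_laurent (Set.mem_univ i)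
      exact ⟨le_localizeAt _ _ this.2.1, le_localizeAt _ _ this.2.2⟩

/-! ### Three mutations at two adjacent vertices -/

/-- The exchange relations along three consecutive mutations at `j`, `k`, `j`, when there are `b`
arrows from `j` to `k`. The coefficients are Laurent monomials in the variables other than those
at `j` and `k`; the last equation relates them. -/
theorem exists_exchange_relations (S : Seed F V) {j k : V} (hjk : j ≠ k)
    (hkj : S.quiver.arrows k j = 0) :
    ∃ p q M N A B : F, IsUnitOf (S.laurent {j, k}ᶜ) p ∧ IsUnitOf (S.laurent {j, k}ᶜ) q ∧
      IsUnitOf (S.laurent {j, k}ᶜ) M ∧ IsUnitOf (S.laurent {j, k}ᶜ) N ∧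
      IsUnitOf (S.laurent {j, k}ᶜ) A ∧ IsUnitOf (S.laurent {j, k}ᶜ) B ∧
      S.exchangeRHS j = p + S.x k ^ S.quiver.arrows j k * q ∧
      (S.mutate j).exchangeRHS k = N + (S.mutate j).x j ^ S.quiver.arrows j k * M ∧
      ((S.mutate j).mutate k).exchangeRHS j =
        B + ((S.mutate j).mutate k).x k ^ S.quiver.arrows j k * A ∧
      A * q * N ^ S.quiver.arrows j k = B * p := by
  classical
  set b := S.quiver.arrows j k with hb
  set S1 := S.mutate j with hS1
  set S2 := S1.mutate k with hS2
  have hq1 : S1.quiver = S.quiver.mutate j := rfl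
  have hq2 : S2.quiver = S1.quiver.mutate k := rfl
  set D : Finset V := (Finset.univ.erase j).erase k with hD
  have hDmem : ∀ i ∈ D, i ≠ j ∧ i ≠ k := by
    intro i hi
    simp only [hD, Finset.mem_erase] at hi
    exact ⟨hi.2.1, hi.1⟩
  have hsplit : ∀ g : V → F, ∏ i, g i = g j * (g k * ∏ i ∈ D, g i) := by
    intro g
    rw [Finset.mul_prod_erase _ _ (by simp [hjk.symm]), Finset.mul_prod_erase _ _ (by simp)]
  have hunit : ∀ e : V → ℕ, IsUnitOf (S.laurent {j, k}ᶜ) (∏ i ∈ D, S.x i ^ e i) := fun e =>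
    IsUnitOf.prod fun i hi => (S.isUnitOf_laurent (by simpa using hDmem i hi)).pow _
  have hx1 : ∀ i ∈ D, S1.x i = S.x i := fun i hi => mutate_x_of_ne _ (hDmem i hi).1
  have hx2 : ∀ i ∈ D, S2.x i = S.x i := fun i hi => by
    rw [hS2, mutate_x_of_ne _ (hDmem i hi).2, hx1 i hi]
  have hprod1 : ∀ e : V → ℕ, ∏ i ∈ D, S1.x i ^ e i = ∏ i ∈ D, S.x i ^ e i := fun e =>
    Finset.prod_congr rfl fun i hi => by rw [hx1 i hi]
  have hprod2 : ∀ e : V → ℕ, ∏ i ∈ D, S2.x i ^ e i = ∏ i ∈ D, S.x i ^ e i := fun e =>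
    Finset.prod_congr rfl fun i hi => by rw [hx2 i hi]
  have h1jk : S1.quiver.arrows j k = 0 := by rw [hq1, ClusterQuiver.mutate_arrows_left, hkj]
  have h1kj : S1.quiver.arrows k j = b := by rw [hq1, ClusterQuiver.mutate_arrows_right]
  have h2jk : S2.quiver.arrows j k = b := by rw [hq2, ClusterQuiver.mutate_arrows_right, h1kj]
  have h2kj : S2.quiver.arrows k j = 0 := by rw [hq2, ClusterQuiver.mutate_arrows_left, h1jk]
  refine ⟨∏ i ∈ D, S.x i ^ S.quiver.arrows i j, ∏ i ∈ D, S.x i ^ S.quiver.arrows j i,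
    ∏ i ∈ D, S.x i ^ S1.quiver.arrows k i, ∏ i ∈ D, S.x i ^ S1.quiver.arrows i k,
    ∏ i ∈ D, S.x i ^ S2.quiver.arrows j i, ∏ i ∈ D, S.x i ^ S2.quiver.arrows i j,
    hunit _, hunit _, hunit _, hunit _, hunit _, hunit _, ?_, ?_, ?_, ?_⟩
  · rw [exchangeRHS, hsplit, hsplit, S.quiver.no_loops, hkj, ← hb]
    ring
  · rw [exchangeRHS, hsplit, hsplit, S1.quiver.no_loops, h1jk, h1kj, hprod1, hprod1]
    ring
  · rw [exchangeRHS, hsplit, hsplit, S2.quiver.no_loops, h2jk, h2kj, hprod2, hprod2]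
    ring
  · rw [← Finset.prod_pow, ← Finset.prod_mul_distrib, ← Finset.prod_mul_distrib,
      ← Finset.prod_mul_distrib]
    refine Finset.prod_congr rfl fun i hi => ?_
    rw [← pow_mul, ← pow_add, ← pow_add, ← pow_add]
    congr 1
    rw [hq2, ClusterQuiver.mutate_arrows_of_ne _ hjk (hDmem i hi).2,
      ClusterQuiver.mutate_arrows_of_ne _ (hDmem i hi).2 hjk, h1jk, h1kj]
    have e1 : S1.quiver.arrows j i = S.quiver.arrows i j := by
      rw [hq1, ClusterQuiver.mutate_arrows_left]
    have e2 : S1.quiver.arrows i j = S.quiver.arrows j i := by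
      rw [hq1, ClusterQuiver.mutate_arrows_right]
    rw [e1, e2]
    simp only [zero_mul, add_zero]
    omega

/-- Suppose that there is an arrow from `j` to `k`, and mutate at `j`, `k`, `j`. The variables `z`
and `w` created by the second and third mutation are Laurent with respect to `S`, and regular modulo
the variable `u` created by the first one. Modulo `u`, the variable `z` is a unit of the Laurent
ring; `w` is a unit if there are at least two arrows, and a linear form in `x j` otherwise. -/
theorem regularMod_of_arrow (S : Seed F V) {j k : V} (hjk : 0 < S.quiver.arrows j k) :
    (((S.mutate j).mutate k).mutate j).x j ∈ S.laurent Set.univ ∧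
    ((S.mutate j).mutate k).x k ∈ S.laurent Set.univ ∧
    RegularMod (S.laurent Set.univ) ((S.mutate j).x j)
      ((((S.mutate j).mutate k).mutate j).x j) ∧
    RegularMod (S.laurent Set.univ) ((S.mutate j).x j) (((S.mutate j).mutate k).x k) := by
  have hne : j ≠ k := by
    rintro rfl
    simp [S.quiver.no_loops] at hjk
  have hkj : S.quiver.arrows k j = 0 := (S.quiver.no_two_cycles j k).resolve_left hjk.ne'
  obtain ⟨p, q, M, N, A, B, hp, hq, hM, hN, hA, hB, e0, e1, e2, e3⟩ :=
    S.exists_exchange_relations hne hkj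
  obtain ⟨c, hc⟩ : ∃ c, S.quiver.arrows j k = c + 1 := ⟨_, (Nat.succ_pred_eq_of_pos hjk).symm⟩
  rw [hc] at e0 e1 e2 e3
  have r0 := S.x_mul_mutate_x j
  have r1 := (S.mutate j).x_mul_mutate_x k
  have r2 := ((S.mutate j).mutate k).x_mul_mutate_x j
  rw [mutate_x_of_ne _ hne.symm, e1] at r1
  rw [mutate_x_of_ne _ hne, e2] at r2
  rw [e0] at r0
  have hu := S.mutate_x_mem_laurent j
  have hu0 := (S.mutate j).x_ne_zero j
  have hP : S.exchangeRHS j ∈ S.laurent {j}ᶜ := S.exchangeRHS_mem_laurent j fun i hi => by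
    have hi : i = j := by simpa using hi
    subst hi
    simp [S.quiver.no_loops]
  have hPu := S.mutate_x_self j
  generalize (S.mutate j).x j = u at *
  generalize ((S.mutate j).mutate k).x k = z at *
  generalize (((S.mutate j).mutate k).mutate j).x j = w at *
  have hj := S.isUnitOf_laurent (Set.mem_univ j)
  have hk := S.isUnitOf_laurent (W := {j}ᶜ) (i := k) (by simpa using hne.symm)
  have hle : S.laurent {j, k}ᶜ ≤ S.laurent {j}ᶜ := S.laurent_mono (by simp)
  have hle' : S.laurent {j}ᶜ ≤ S.laurent Set.univ := S.laurent_mono (Set.subset_univ _)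
  replace hp := hp.mono hle
  replace hq := hq.mono hle
  replace hM := hM.mono hle
  replace hN := hN.mono hle
  replace hA := hA.mono hle
  replace hB := hB.mono hle
  have hp0 := hp.1
  have hq0 := hq.1
  have hN0 := hN.1
  have hB0 := hB.1
  have hj0 := hj.1
  have hk0 := hk.1
  -- In the expansion of `w`, the geometric sum is `((1 + t) ^ (c + 1) - 1) / t` for
  -- `t = u ^ (c + 1) * (M / N)`, which cancels the denominator `u` of `w`.
  have ez : z = N / S.x k + u * (u ^ c * (M / S.x k)) := by
    field_simp
    linear_combination r1
  have hμ := (hk.pow (c + 1)).mul hq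
  have ew : w = B / (S.x k ^ (c + 1) * q) * S.x j +
      B * (p / (S.x k ^ (c + 1) * q)) * (M / N) *
        (u ^ c * ∑ l ∈ Finset.range (c + 1), (1 + u ^ (c + 1) * (M / N)) ^ l) := by
    have hgeom := mul_geom_sum (1 + u ^ (c + 1) * (M / N)) (c + 1)
    have ez' : z = N / S.x k * (1 + u ^ (c + 1) * (M / N)) := by
      rw [ez]; field_simp; ring
    have eA : A = B * p / (q * N ^ (c + 1)) := by
      field_simp
      linear_combination e3
    generalize ∑ l ∈ Finset.range (c + 1), (1 + u ^ (c + 1) * (M / N)) ^ l = s at *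
    have hpow : (1 + u ^ (c + 1) * (M / N)) ^ (c + 1) = 1 + u ^ (c + 1) * (M / N) * s := by
      linear_combination -hgeom
    rw [ez', eA, mul_pow, hpow] at r2
    apply mul_left_cancel₀ hu0
    rw [r2]
    have : B / (S.x k ^ (c + 1) * q) * (S.x j * u) =
        B / (S.x k ^ (c + 1) * q) * (p + S.x k ^ (c + 1) * q) := by rw [r0]
    have h2 : B / (S.x k ^ (c + 1) * q) * (p + S.x k ^ (c + 1) * q) =
        B + B * (p / (S.x k ^ (c + 1) * q)) := by field_simp; ring
    have h3 : (N / S.x k) ^ (c + 1) * (1 + u ^ (c + 1) * (M / N) * s) * (B * p / (q * N ^ (c + 1)))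
        = B * (p / (S.x k ^ (c + 1) * q)) * (1 + u ^ (c + 1) * (M / N) * s) := by
      rw [div_pow]; field_simp
    rw [h3]
    linear_combination -this - h2
  have hMN := hM.div hN
  have hpμ := hp.div hμ
  have hBμ := hB.div hμ
  have hs : ∑ l ∈ Finset.range (c + 1), (1 + u ^ (c + 1) * (M / N)) ^ l ∈ S.laurent Set.univ :=
    sum_mem fun l _ => pow_mem (add_mem (one_mem _)
      (mul_mem (pow_mem hu _) (hle' hMN.2.1))) _
  have hMk : u ^ c * (M / S.x k) ∈ S.laurent Set.univ :=
    mul_mem (pow_mem hu _) (hle' (hM.div hk).2.1)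
  have hNk := (hN.div hk).mono hle'
  refine ⟨?_, ?_, ?_, ?_⟩
  · rw [ew]
    exact add_mem (mul_mem (hle' hBμ.2.1) hj.2.1)
      (mul_mem (hle' ((hB.mul hpμ).mul hMN).2.1) (mul_mem (pow_mem hu _) hs))
  · rw [ez]
    exact add_mem hNk.2.1 (mul_mem hu hMk)
  · rw [ew]
    rcases c with _ | c
    · -- a single arrow: `w` is linear in `x j`, and `u` equals `S.exchangeRHS j` up to a unit
      have h := S.regularMod_linear j hP hBμ ((hB.mul hpμ).mul hMN).2.1
      have h' := h.modulus_unit hj.inv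
      rw [← div_eq_mul_inv, ← hPu] at h'
      simpa using h'
    · -- several arrows: the second summand is divisible by `u`
      have h := (RegularMod.of_unit (u := u) ((hBμ.mono hle').mul hj)).add_mul
        (d := B * (p / (S.x k ^ (c + 1 + 1) * q)) * (M / N) *
        (u ^ c * ∑ l ∈ Finset.range (c + 1 + 1), (1 + u ^ (c + 1 + 1) * (M / N)) ^ l))
        (mul_mem (hle' ((hB.mul hpμ).mul hMN).2.1) (mul_mem (pow_mem hu _) hs))
      convert h using 1
      ring
  · rw [ez]
    exact (RegularMod.of_unit hNk).add_mul hMk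

end Seed

/-! ### Adjoining a frozen variable and specializing it to `1` -/

section Specialization

variable {F : Type v} [Field F]

open Polynomial

/-- The rational function `a` is regular at `1`, where its value is `b`. -/
def SpecializesTo (a : RatFunc F) (b : F) : Prop :=
  ∃ p q : F[X], q.eval 1 ≠ 0 ∧ a * algebraMap F[X] (RatFunc F) q = algebraMap F[X] (RatFunc F) p ∧
    b * q.eval 1 = p.eval 1

namespace SpecializesTo

variable {a a' : RatFunc F} {b b' : F}

theorem C (b : F) : SpecializesTo (RatFunc.C b) b :=
  ⟨Polynomial.C b, 1, by simp, by simp, by simp⟩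

theorem X : SpecializesTo (RatFunc.X : RatFunc F) 1 :=
  ⟨Polynomial.X, 1, by simp, by simp, by simp⟩

theorem one : SpecializesTo (1 : RatFunc F) 1 := by simpa using SpecializesTo.C (1 : F)

theorem unique (h : SpecializesTo a b) (h' : SpecializesTo a b') : b = b' := by
  obtain ⟨p, q, hq, ha, hb⟩ := h
  obtain ⟨p', q', hq', ha', hb'⟩ := h'
  have e : p * q' = p' * q := by
    apply RatFunc.algebraMap_injective F
    rw [map_mul, map_mul, ← ha, ← ha']
    ring
  have e' := congrArg (Polynomial.eval 1) e
  rw [eval_mul, eval_mul, ← hb, ← hb'] at e'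
  have : (b - b') * (q.eval 1 * q'.eval 1) = 0 := by linear_combination e'
  exact sub_eq_zero.1 ((mul_eq_zero.1 this).resolve_right (mul_ne_zero hq hq'))

theorem add (h : SpecializesTo a b) (h' : SpecializesTo a' b') :
    SpecializesTo (a + a') (b + b') := by
  obtain ⟨p, q, hq, ha, hb⟩ := h
  obtain ⟨p', q', hq', ha', hb'⟩ := h'
  refine ⟨p * q' + p' * q, q * q', by rw [eval_mul]; exact mul_ne_zero hq hq', ?_, ?_⟩
  · simp only [map_mul, map_add, ← ha, ← ha']; ring
  · simp only [eval_mul, eval_add, ← hb, ← hb']; ring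

theorem neg (h : SpecializesTo a b) : SpecializesTo (-a) (-b) := by
  obtain ⟨p, q, hq, ha, hb⟩ := h
  exact ⟨-p, q, hq, by rw [map_neg, ← ha, neg_mul], by rw [eval_neg, ← hb, neg_mul]⟩

theorem mul (h : SpecializesTo a b) (h' : SpecializesTo a' b') :
    SpecializesTo (a * a') (b * b') := by
  obtain ⟨p, q, hq, ha, hb⟩ := h
  obtain ⟨p', q', hq', ha', hb'⟩ := h'
  refine ⟨p * p', q * q', by rw [eval_mul]; exact mul_ne_zero hq hq', ?_, ?_⟩
  · simp only [map_mul, ← ha, ← ha']; ring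
  · simp only [eval_mul, ← hb, ← hb']; ring

theorem inv (h : SpecializesTo a b) (hb0 : b ≠ 0) : SpecializesTo a⁻¹ b⁻¹ := by
  obtain ⟨p, q, hq, ha, hb⟩ := h
  have hp : p.eval 1 ≠ 0 := by rw [← hb]; exact mul_ne_zero hb0 hq
  have ha0 : a ≠ 0 := by
    rintro rfl
    rw [zero_mul, eq_comm, map_eq_zero_iff _ (RatFunc.algebraMap_injective F)] at ha
    simp [ha] at hp
  refine ⟨q, p, hp, ?_, ?_⟩
  · rw [← ha, inv_mul_cancel_left₀ ha0]
  · rw [← hb, inv_mul_cancel_left₀ hb0]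

theorem pow (h : SpecializesTo a b) (n : ℕ) : SpecializesTo (a ^ n) (b ^ n) := by
  induction n with
  | zero => simpa using SpecializesTo.one
  | succ n ih => rw [pow_succ, pow_succ]; exact ih.mul h

theorem prod {ι : Type*} {s : Finset ι} {a : ι → RatFunc F} {b : ι → F}
    (h : ∀ i, SpecializesTo (a i) (b i)) : SpecializesTo (∏ i ∈ s, a i) (∏ i ∈ s, b i) := by
  classical
  induction s using Finset.induction_on with
  | empty => simpa using SpecializesTo.one
  | insert i s hi ih => rw [Finset.prod_insert hi, Finset.prod_insert hi]; exact (h i).mul ih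

end SpecializesTo

end Specialization

namespace ClusterQuiver

variable {V : Type u}

open scoped Classical in
/-- The quiver obtained by adding a vertex `none` and a single arrow from `k` to it. -/
noncomputable def extend (Q : ClusterQuiver V) (k : V) : ClusterQuiver (Option V) where
  arrows
    | some i, some j => Q.arrows i j
    | some i, none => if i = k then 1 else 0
    | none, _ => 0
  no_loops i := by cases i <;> simp [Q.no_loops]
  no_two_cycles i j := by
    cases i <;> cases j <;> simp [Q.no_two_cycles]

end ClusterQuiver

namespace Seed

variable {F : Type v} [Field F] [CharZero F] {V : Type u}

/-- The seed obtained by adding a frozen vertex `none` with a new variable, and a single arrow from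
`k` to it. -/
noncomputable def extend (S : Seed F V) (k : V) : Seed (RatFunc F) (Option V) where
  quiver := S.quiver.extend k
  frozen := insert none (some '' S.frozen)
  x o := o.elim RatFunc.X (fun i => algebraMap F (RatFunc F) (S.x i))
  algebraicIndependent := by
    have h1 : AlgebraicIndependent ℚ (fun i => algebraMap F (RatFunc F) (S.x i)) :=
      S.algebraicIndependent.map' (f := IsScalarTower.toAlgHom ℚ F (RatFunc F))
        (algebraMap F (RatFunc F)).injective
    rw [AlgebraicIndependent.option_iff_transcendental h1]
    intro h
    obtain ⟨p, hp, hp'⟩ := h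
    have hle : ∀ a ∈ Algebra.adjoin ℚ (Set.range fun i => algebraMap F (RatFunc F) (S.x i)),
        ∃ b, algebraMap F (RatFunc F) b = a := by
      intro a ha
      have : Algebra.adjoin ℚ (Set.range fun i => algebraMap F (RatFunc F) (S.x i)) ≤
          (IsScalarTower.toAlgHom ℚ F (RatFunc F)).range := by
        refine Algebra.adjoin_le ?_
        rintro _ ⟨i, rfl⟩
        exact ⟨S.x i, rfl⟩
      exact this ha
    refine RatFunc.transcendental_X (K := F) ?_
    choose g hg using hle
    have hinj := (algebraMap F (RatFunc F)).injective
    let φ : Algebra.adjoin ℚ (Set.range fun i => algebraMap F (RatFunc F) (S.x i)) →+* F :=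
      { toFun a := g a a.2
        map_one' := hinj (by rw [hg, map_one]; rfl)
        map_mul' a b := hinj (by rw [map_mul, hg, hg, hg]; rfl)
        map_zero' := hinj (by rw [hg, map_zero]; rfl)
        map_add' a b := hinj (by rw [map_add, hg, hg, hg]; rfl) }
    have hφ : (algebraMap F (RatFunc F)).comp φ = algebraMap _ _ := by
      ext a
      exact hg a a.2
    refine ⟨p.map φ, ?_, ?_⟩
    · rw [Ne, Polynomial.map_eq_zero_iff]
      · exact hp
      · intro a b hab
        apply Subtype.ext
        rw [← hg a a.2, ← hg b b.2]
        exact congrArg _ hab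
    · rw [← hp', Polynomial.aeval_def, Polynomial.eval₂_map, hφ, ← Polynomial.aeval_def]
  adjoin_eq_top := by
    rw [eq_top_iff]
    set K := IntermediateField.adjoin ℚ
      (Set.range fun o : Option V => o.elim RatFunc.X (fun i => algebraMap F (RatFunc F) (S.x i)))
    have hX : (RatFunc.X : RatFunc F) ∈ K := IntermediateField.subset_adjoin _ _ ⟨none, rfl⟩
    have hC : ∀ a : F, algebraMap F (RatFunc F) a ∈ K := by
      have : (⊤ : IntermediateField ℚ F) ≤ K.comap (IsScalarTower.toAlgHom ℚ F (RatFunc F)) := by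
        rw [← S.adjoin_eq_top, IntermediateField.adjoin_le_iff]
        rintro _ ⟨i, rfl⟩
        exact IntermediateField.subset_adjoin _ _ ⟨some i, rfl⟩
      exact fun a => this IntermediateField.mem_top
    have hp : ∀ p : Polynomial F, algebraMap (Polynomial F) (RatFunc F) p ∈ K := by
      intro p
      induction p using Polynomial.induction_on' with
      | add p q hp hq => rw [map_add]; exact add_mem hp hq
      | monomial n a =>
        rw [RatFunc.algebraMap_monomial]
        exact mul_mem (hC a) (pow_mem hX n)
    intro a _
    rw [← RatFunc.num_div_denom a]
    exact div_mem (hp _) (hp _)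

/-- The seed `S'` with an additional variable becomes `S` when that variable is set to `1`. -/
structure Specializes (S' : Seed (RatFunc F) (Option V)) (S : Seed F V) : Prop where
  arrows : ∀ i j, S'.quiver.arrows (some i) (some j) = S.quiver.arrows i j
  x_some : ∀ i, SpecializesTo (S'.x (some i)) (S.x i)
  x_none : SpecializesTo (S'.x none) 1

theorem specializes_extend (S : Seed F V) (k : V) : (S.extend k).Specializes S :=
  ⟨fun _ _ => rfl, fun i => SpecializesTo.C (S.x i), SpecializesTo.X⟩

theorem Specializes.exists_of_mem_laurent {S' : Seed (RatFunc F) (Option V)} {S : Seed F V}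
    (h : S'.Specializes S) {a : RatFunc F} (ha : a ∈ S'.laurent Set.univ) :
    ∃ b ∈ S.laurent Set.univ, SpecializesTo a b := by
  induction ha using Subring.closure_induction with
  | mem y hy =>
    rcases hy with ⟨o, -, rfl⟩ | ⟨o, -, rfl⟩ <;> rcases o with _ | i
    · exact ⟨1, one_mem _, h.x_none⟩
    · exact ⟨_, (S.isUnitOf_laurent (Set.mem_univ i)).2.1, h.x_some i⟩
    · exact ⟨1⁻¹, by rw [inv_one]; exact one_mem _, h.x_none.inv one_ne_zero⟩
    · exact ⟨_, (S.isUnitOf_laurent (Set.mem_univ i)).2.2, (h.x_some i).inv (S.x_ne_zero i)⟩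
  | zero => exact ⟨0, zero_mem _, by simpa using SpecializesTo.C (0 : F)⟩
  | one => exact ⟨1, one_mem _, SpecializesTo.one⟩
  | add a b _ _ ha hb =>
    obtain ⟨a', ha', ha⟩ := ha
    obtain ⟨b', hb', hb⟩ := hb
    exact ⟨a' + b', add_mem ha' hb', ha.add hb⟩
  | neg a _ ha =>
    obtain ⟨a', ha', ha⟩ := ha
    exact ⟨-a', neg_mem ha', ha.neg⟩
  | mul a b _ _ ha hb =>
    obtain ⟨a', ha', ha⟩ := ha
    obtain ⟨b', hb', hb⟩ := hb
    exact ⟨a' * b', mul_mem ha' hb', ha.mul hb⟩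

variable [Fintype V]

theorem Specializes.mutate {S' : Seed (RatFunc F) (Option V)} {S : Seed F V}
    (h : S'.Specializes S) (k : V) : (S'.mutate (some k)).Specializes (S.mutate k) := by
  have hR : SpecializesTo (S'.exchangeRHS (some k)) (S.exchangeRHS k) := by
    rw [exchangeRHS, Fintype.prod_option, Fintype.prod_option]
    refine .add ?_ ?_
    · rw [← one_mul (∏ i, S.x i ^ _), ← one_pow (S'.quiver.arrows none (some k))]
      refine (h.x_none.pow _).mul (.prod fun i => ?_)
      rw [h.arrows]
      exact (h.x_some i).pow _
    · rw [← one_mul (∏ i, S.x i ^ _), ← one_pow (S'.quiver.arrows (some k) none)]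
      refine (h.x_none.pow _).mul (.prod fun i => ?_)
      rw [h.arrows]
      exact (h.x_some i).pow _
  refine ⟨fun i j => ?_, fun i => ?_, ?_⟩
  · change (S'.quiver.mutate (some k)).arrows _ _ = (S.quiver.mutate k).arrows i j
    by_cases hij : i = k ∨ j = k
    · have hij' : some i = some k ∨ some j = some k := by simpa using hij
      simp only [ClusterQuiver.mutate, if_pos hij, if_pos hij', h.arrows]
    · have hij' : ¬ (some i = some k ∨ some j = some k) := by simpa using hij
      simp only [ClusterQuiver.mutate, if_neg hij, if_neg hij', h.arrows]
  · by_cases hi : i = k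
    · subst hi
      rw [mutate_x_self, mutate_x_self, div_eq_mul_inv, div_eq_mul_inv]
      exact hR.mul ((h.x_some i).inv (S.x_ne_zero i))
    · rw [mutate_x_of_ne _ hi, mutate_x_of_ne _ (by simpa using hi)]
      exact h.x_some i
  · rw [mutate_x_of_ne _ (by simp)]
    exact h.x_none

/-! ### The Laurent phenomenon -/

/-- Iterated mutation along a list of vertices. -/
noncomputable def mutateList (S : Seed F V) (l : List V) : Seed F V :=
  l.foldl (fun T k => T.mutate k) S

theorem mutateList_cons (S : Seed F V) (k : V) (l : List V) :
    S.mutateList (k :: l) = (S.mutate k).mutateList l := rfl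

theorem MutEquiv.exists_mutateList {S T : Seed F V} (h : S.MutEquiv T) :
    ∃ l, T = S.mutateList l := by
  induction h with
  | refl => exact ⟨[], rfl⟩
  | tail _ h ih =>
    obtain ⟨k, -, rfl⟩ := h
    obtain ⟨l, rfl⟩ := ih
    exact ⟨l ++ [k], by simp [mutateList]⟩

theorem Specializes.mutateList {S' : Seed (RatFunc F) (Option V)} {S : Seed F V}
    (h : S'.Specializes S) (l : List V) :
    (S'.mutateList (l.map some)).Specializes (S.mutateList l) := by
  induction l generalizing S S' with
  | nil => exact h
  | cons k l ih => exact ih (h.mutate k)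

/-- In the seed extended at `k`, the exchange polynomial at `k` is linear in the new variable, so
it is regular modulo any exchange polynomial at a vertex `j ≠ k`. -/
theorem regularMod_extend (S : Seed F V) {j k : V} (hjk : j ≠ k) :
    RegularMod ((S.extend k).laurent Set.univ) ((S.extend k).exchangeRHS (some j))
      ((S.extend k).exchangeRHS (some k)) := by
  have hj : (S.extend k).exchangeRHS (some j) ∈ (S.extend k).laurent {none}ᶜ := by
    refine exchangeRHS_mem_laurent _ _ fun o ho => ?_
    have ho : o = none := by simpa using ho
    subst ho
    exact ⟨rfl, if_neg hjk⟩
  have hu : ∀ e : V → ℕ, IsUnitOf ((S.extend k).laurent {none}ᶜ)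
      (∏ i, (S.extend k).x (some i) ^ e i) := fun e =>
    IsUnitOf.prod fun i _ => ((S.extend k).isUnitOf_laurent (by simp)).pow _
  have e1 : (S.extend k).quiver.arrows none (some k) = 0 := rfl
  have e2 : (S.extend k).quiver.arrows (some k) none = 1 := if_pos rfl
  have h := (S.extend k).regularMod_linear none hj
    (hu fun i => (S.extend k).quiver.arrows (some k) (some i))
    (hu fun i => (S.extend k).quiver.arrows (some i) (some k)).2.1
  convert h using 1
  rw [exchangeRHS, Fintype.prod_option, Fintype.prod_option, e1, e2]
  ring

/-- The Laurent phenomenon, by induction on the length `d` of the mutation path: `x` is Laurent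
with respect to `μ_j S`, and with respect to `μ_j μ_k μ_j S`, from which the path is also shorter.
The denominators of the two expansions are compared in the Laurent ring of `S`. If the first two
mutations are at adjacent vertices, they are coprime; otherwise they become coprime after a
variable is adjoined, and the resulting expansion is specialized. -/
theorem mutateList_x_mem_laurent (d : ℕ) : ∀ {F : Type v} [Field F] [CharZero F] {V : Type u}
    [Fintype V] (S : Seed F V) (l : List V), l.length ≤ d → ∀ i,
    (S.mutateList l).x i ∈ S.laurent Set.univ := by
  induction d using Nat.strong_induction_on with
  | _ d ih =>
  intro F _ _ V _ S l hl i
  rcases l with _ | ⟨j, _ | ⟨k, l⟩⟩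
  · exact (S.isUnitOf_laurent (Set.mem_univ i)).2.1
  · change (S.mutate j).x i ∈ _
    by_cases hi : i = j
    · subst hi
      exact S.mutate_x_mem_laurent i
    · rw [mutate_x_of_ne _ hi]
      exact (S.isUnitOf_laurent (Set.mem_univ i)).2.1
  simp only [List.length_cons] at hl
  by_cases hjk : j = k
  · subst hjk
    rw [mutateList_cons, mutateList_cons, mutate_mutate]
    exact ih (d - 1) (by omega) S l (by omega) i
  have ih1 : ∀ {F : Type v} [Field F] [CharZero F] {V : Type u} [Fintype V] (S : Seed F V)
      (j k : V) (l' : List V), l'.length = l.length → ∀ i,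
      (S.mutateList (j :: k :: l')).x i ∈ (S.mutate j).laurent Set.univ :=
    fun S j k l' hl' i => ih (d - 1) (by omega) (S.mutate j) (k :: l') (by simp; omega) i
  have ih3 : ∀ {F : Type v} [Field F] [CharZero F] {V : Type u} [Fintype V] (S : Seed F V)
      (j k : V) (l' : List V), l'.length = l.length → ∀ i,
      (S.mutateList (j :: k :: l')).x i ∈
        (((S.mutate j).mutate k).mutate j).laurent Set.univ := by
    intro F _ _ V _ S j k l' hl' i
    have := ih (d - 1) (by omega) (((S.mutate j).mutate k).mutate j) (j :: l') (by simp; omega) i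
    rwa [mutateList_cons, mutate_mutate] at this
  rcases Nat.eq_zero_or_pos (S.quiver.arrows j k) with h0 | hpos
  · rcases Nat.eq_zero_or_pos (S.quiver.arrows k j) with h0' | hpos'
    · -- Without arrows between `j` and `k`, the new variables are the exchange polynomials up to
      -- units, which can have common factors; in the seed extended at `k` they have none.
      set E := S.extend k with hE
      have hne : some j ≠ some k := by simpa using hjk
      have a1 : E.quiver.arrows (some j) (some k) = 0 := h0
      have a2 : E.quiver.arrows (some k) (some j) = 0 := h0'
      have b1 : (E.mutate (some j)).quiver.arrows (some j) (some k) = 0 := by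
        change (E.quiver.mutate (some j)).arrows _ _ = 0
        rw [ClusterQuiver.mutate_arrows_left, a2]
      have b2 : (E.mutate (some j)).quiver.arrows (some k) (some j) = 0 := by
        change (E.quiver.mutate (some j)).arrows _ _ = 0
        rw [ClusterQuiver.mutate_arrows_right, a1]
      have hz : ((E.mutate (some j)).mutate (some k)).x (some k) =
          (E.x (some k))⁻¹ * E.exchangeRHS (some k) := by
        rw [mutate_x_self, mutate_x_of_ne _ hne.symm,
          E.exchangeRHS_mutate_of_not_adj hne.symm a1 a2, div_eq_inv_mul]
      have hw : (((E.mutate (some j)).mutate (some k)).mutate (some j)).x (some j) =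
          E.x (some j) := by
        rw [mutate_x_self, exchangeRHS_mutate_of_not_adj _ hne b2 b1, exchangeRHS_mutate_self,
          mutate_x_of_ne _ hne, mutate_x_self, div_div_cancel₀ (E.exchangeRHS_ne_zero _)]
      have hu : (E.mutate (some j)).x (some j) =
          E.exchangeRHS (some j) * (E.x (some j))⁻¹ := by
        rw [mutate_x_self, div_eq_mul_inv]
      have uj := E.isUnitOf_laurent (Set.mem_univ (some j))
      have uk := E.isUnitOf_laurent (Set.mem_univ (some k))
      have hx : (E.mutateList ((j :: k :: l).map some)).x (some i) ∈ E.laurent Set.univ := by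
        refine E.mem_laurent_of_regularMod hne ?_ ?_ ?_ ?_
          (ih1 E (some j) (some k) (l.map some) (by simp) (some i))
          (ih3 E (some j) (some k) (l.map some) (by simp) (some i))
        · rw [hw]
          exact uj.2.1
        · rw [hz]
          exact mul_mem uk.2.2 (E.exchangeRHS_mem_laurent _ fun o ho => absurd (Set.mem_univ o) ho)
        · rw [hw]
          exact RegularMod.of_unit uj
        · rw [hz, hu]
          exact ((S.regularMod_extend hjk).unit_mul uk.inv).modulus_unit uj.inv
      obtain ⟨b, hb, hb'⟩ := (S.specializes_extend k).exists_of_mem_laurent hx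
      rwa [((S.specializes_extend k).mutateList (j :: k :: l)).x_some i |>.unique hb']
    · -- reversing all arrows changes neither the mutated clusters nor the Laurent rings
      obtain ⟨hw, hz, hwr, hzr⟩ := S.op.regularMod_of_arrow (j := j) (k := k) hpos'
      simp only [op_mutate] at hw hz hwr hzr
      exact S.mem_laurent_of_regularMod hjk hw hz hwr hzr (ih1 S j k l rfl i) (ih3 S j k l rfl i)
  · obtain ⟨hw, hz, hwr, hzr⟩ := S.regularMod_of_arrow hpos
    exact S.mem_laurent_of_regularMod hjk hw hz hwr hzr (ih1 S j k l rfl i) (ih3 S j k l rfl i)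

theorem MutEquiv.x_mem_laurent {S T : Seed F V} (h : S.MutEquiv T) (i : V) :
    T.x i ∈ S.laurent Set.univ := by
  obtain ⟨l, rfl⟩ := h.exists_mutateList
  exact mutateList_x_mem_laurent _ S l le_rfl i

theorem clusterAlgebra_le_laurent (S : Seed F V) : S.clusterAlgebra ≤ S.laurent Set.univ := by
  refine Subring.closure_le.2 (Set.union_subset ?_ ?_)
  · rintro _ ⟨T, hT, i, rfl⟩
    exact hT.x_mem_laurent i
  · rintro _ ⟨i, -, rfl⟩
    exact (S.isUnitOf_laurent (Set.mem_univ i)).2.2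

end Seed

namespace Seed

variable {F : Type v} [Field F] [CharZero F] {V : Type u}

/-! ### Seeds without arrows between mutable vertices -/

/-- There are no arrows between mutable vertices. -/
def MutablesEdgeless (S : Seed F V) : Prop :=
  ∀ a ∉ S.frozen, ∀ b ∉ S.frozen, S.quiver.arrows a b = 0

theorem MutablesEdgeless.isAcyclic {S : Seed F V} (h : S.MutablesEdgeless) :
    S.mutableQuiver.IsAcyclic := by
  intro i hi
  obtain ⟨c, hc, -⟩ := Relation.TransGen.head'_iff.1 hi
  exact hc.ne' (h _ i.2 _ c.2)

variable [Fintype V]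

open scoped Classical in
/-- The cluster obtained from that of `S` by exchanging the variables at the vertices in `E`, when
no two of these vertices are connected by arrows. -/
noncomputable def exchanged (S : Seed F V) (E : Finset V) (i : V) : F :=
  if i ∈ E then S.exchangeRHS i / S.x i else S.x i

theorem MutablesEdgeless.mutate {S : Seed F V} (h : S.MutablesEdgeless) {k : V}
    (hk : k ∉ S.frozen) : (S.mutate k).MutablesEdgeless := by
  intro a ha b hb
  change (S.quiver.mutate k).arrows a b = 0
  have h1 := h a ha b hb
  have h2 := h b hb a ha
  have h3 := h a ha k hk
  have h4 := h k hk b hb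
  simp [ClusterQuiver.mutate, h1, h2, h3, h4]

theorem MutablesEdgeless.exists_exchanged {S : Seed F V} (h : S.MutablesEdgeless) (E : Finset V)
    (hE : ∀ i ∈ E, i ∉ S.frozen) : ∃ T, S.MutEquiv T ∧ T.x = S.exchanged E := by
  classical
  suffices ∃ T, S.MutEquiv T ∧ T.x = S.exchanged E ∧ T.MutablesEdgeless ∧
      ∀ k ∉ S.frozen, T.exchangeRHS k = S.exchangeRHS k by
    obtain ⟨T, h1, h2, -⟩ := this
    exact ⟨T, h1, h2⟩
  induction E using Finset.induction_on with
  | empty => exact ⟨S, Relation.ReflTransGen.refl, by ext; simp [exchanged], h, fun _ _ => rfl⟩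
  | insert k E hk ih =>
    obtain ⟨T, hT, hTx, hTe, hTR⟩ := ih fun i hi => hE i (Finset.mem_insert_of_mem hi)
    have hkS : k ∉ S.frozen := hE k (Finset.mem_insert_self _ _)
    have hkT : k ∉ T.frozen := by rwa [hT.frozen_eq]
    refine ⟨T.mutate k, hT.trans (T.mutEquiv_mutate hkT), ?_, hTe.mutate hkT, ?_⟩
    · ext i
      by_cases hi : i = k
      · subst hi
        rw [mutate_x_self, hTR i hkS, hTx]
        simp [exchanged, hk]
      · rw [mutate_x_of_ne _ hi, hTx]
        simp [exchanged, hi]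
    · intro l hl
      by_cases hlk : l = k
      · subst hlk
        rw [exchangeRHS_mutate_self, hTR l hl]
      · have hlT : l ∉ T.frozen := by rwa [hT.frozen_eq]
        rw [T.exchangeRHS_mutate_of_not_adj hlk (hTe _ hkT _ hlT) (hTe _ hlT _ hkT), hTR l hl]

theorem MutablesEdgeless.exchangeRHS_mem_laurent {S : Seed F V} (h : S.MutablesEdgeless) {k : V}
    (hk : k ∉ S.frozen) : S.exchangeRHS k ∈ S.laurent S.frozen :=
  S.exchangeRHS_mem_laurent k fun i hi => ⟨h i hi k hk, h k hk i hi⟩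

open scoped Classical in
/-- Generators at the vertex `i`: the two exchangeable variables if `i ∈ D`, and the variable of
the cluster `S.exchanged E` together with its inverse otherwise. -/
noncomputable def localGenerators (S : Seed F V) (D E : Finset V) (i : V) : Set F :=
  if i ∈ D then {S.x i, S.exchangeRHS i / S.x i} else {S.exchanged E i, (S.exchanged E i)⁻¹}

/-- If there are no arrows between mutable vertices, then an element that is a Laurent polynomial
in each of the clusters lies in the cluster algebra. The mutable vertices are treated one after the
other: `D` is the set of those at which no inverses are needed any more. -/
theorem MutablesEdgeless.mem_clusterAlgebra {S : Seed F V} (h : S.MutablesEdgeless) {f : F}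
    (hf : ∀ T, S.MutEquiv T → f ∈ T.laurent Set.univ) : f ∈ S.clusterAlgebra := by
  classical
  have key : ∀ D : Finset V, (∀ i ∈ D, i ∉ S.frozen) → ∀ E : Finset V, (∀ i ∈ E, i ∉ S.frozen) →
      f ∈ Subring.closure (⋃ i, S.localGenerators D E i) := by
    intro D
    induction D using Finset.induction_on with
    | empty =>
      intro _ E hE
      obtain ⟨T, hT, hTx⟩ := h.exists_exchanged E hE
      refine T.laurent_le_iff.2 (fun i _ => ?_) (hf T hT)
      rw [hTx]
      constructor <;> refine Subring.subset_closure (Set.mem_iUnion.2 ⟨i, ?_⟩) <;>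
        simp [localGenerators]
    | insert k D hk ih =>
      intro hD E hE
      have hkS : k ∉ S.frozen := hD k (Finset.mem_insert_self _ _)
      have hD' : ∀ i ∈ D, i ∉ S.frozen := fun i hi => hD i (Finset.mem_insert_of_mem hi)
      set B := Subring.closure (⋃ i ∈ ({k}ᶜ : Set V), S.localGenerators D E i) with hB
      have hBmem : ∀ i, i ≠ k → ∀ y ∈ S.localGenerators D E i, y ∈ B := fun i hi y hy =>
        Subring.subset_closure (Set.mem_iUnion₂.2 ⟨i, hi, hy⟩)
      have h0 := ih hD' (E.erase k) fun i hi => hE i (Finset.mem_of_mem_erase hi)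
      have h1 := ih hD' (insert k E) fun i hi => by
        rcases Finset.mem_insert.1 hi with rfl | hi
        exacts [hkS, hE i hi]
      have hfro : S.laurent S.frozen ≤ B := by
        refine S.laurent_le_iff.2 fun i hi => ?_
        have hik : i ≠ k := by rintro rfl; exact hkS hi
        have hiD : i ∉ D := fun hiD => hD' i hiD hi
        have hiE : i ∉ E := fun hiE => hE i hiE hi
        constructor <;> apply hBmem i hik <;> simp [localGenerators, exchanged, hiD, hiE]
      -- `B` contains the exchange polynomial at `k`, and `x k` is transcendental over `B`, so the
      -- one-variable statement applies to the expansions with `k ∉ E` and with `k ∈ E`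
      have hP := hfro (h.exchangeRHS_mem_laurent hkS)
      have htr : Transcendental B (S.x k) := by
        refine S.transcendental k fun b hb => ?_
        set K := IntermediateField.adjoin ℚ (S.x '' {k}ᶜ)
        have hx : ∀ i, i ≠ k → S.x i ∈ K := fun i hi =>
          IntermediateField.subset_adjoin _ _ ⟨i, hi, rfl⟩
        have hx' : ∀ i, i ∉ S.frozen → i ≠ k → S.exchangeRHS i / S.x i ∈ K := fun i hi hik =>
          div_mem (S.mem_adjoin_of_mem_laurent (by simpa using hkS)
            (h.exchangeRHS_mem_laurent hi)) (hx i hik)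
        have hy : ∀ i, i ≠ k → S.exchanged E i ∈ K := by
          intro i hik
          unfold exchanged
          split_ifs with hi
          · exact hx' i (hE i hi) hik
          · exact hx i hik
        refine (Subring.closure_le (t := K.toSubfield.toSubring)).2 ?_ hb
        refine Set.iUnion₂_subset fun i hik => ?_
        unfold localGenerators
        split_ifs with hi
        · rintro _ (rfl | rfl)
          exacts [hx i hik, hx' i (hD' i hi) hik]
        · rintro _ (rfl | rfl)
          exacts [hy i hik, K.inv_mem (hy i hik)]
      have hgen : ∀ E' : Finset V, (∀ i, i ≠ k → (i ∈ E' ↔ i ∈ E)) → ∀ i, i ≠ k →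
          S.localGenerators D E' i = S.localGenerators D E i := by
        intro E' hE' i hi
        simp [localGenerators, exchanged, hE' i hi]
      have hle : ∀ E' : Finset V, (∀ i, i ≠ k → (i ∈ E' ↔ i ∈ E)) →
          Subring.closure (⋃ i, S.localGenerators D E' i) ≤
            Subring.closure ((B : Set F) ∪ {S.exchanged E' k, (S.exchanged E' k)⁻¹}) := by
        intro E' hE'
        refine Subring.closure_le.2 (Set.iUnion_subset fun i => ?_)
        by_cases hi : i = k
        · subst hi
          rw [localGenerators, if_neg hk]
          exact Set.subset_union_right.trans Subring.subset_closure
        · rw [hgen E' hE' i hi]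
          exact fun y hy => Subring.subset_closure (Or.inl (hBmem i hi y hy))
      have h0' := hle (E.erase k) (fun i hi => by simp [hi]) h0
      have h1' := hle (insert k E) (fun i hi => by simp [hi]) h1
      have e0 : S.exchanged (E.erase k) k = S.x k := by simp [exchanged]
      have e1 : S.exchanged (insert k E) k = S.exchangeRHS k / S.x k := by simp [exchanged]
      rw [e0] at h0'
      rw [e1] at h1'
      have hfin := mem_closure_of_mem_of_mem B htr hP (S.exchangeRHS_ne_zero k)
        (mul_div_cancel₀ _ (S.x_ne_zero k)) h0' h1'
      refine Subring.closure_le.2 (Set.union_subset (Subring.closure_le.2 ?_) ?_) hfin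
      · refine Set.iUnion₂_subset fun i hik y hy => ?_
        refine Subring.subset_closure (Set.mem_iUnion.2 ⟨i, ?_⟩)
        have : i ≠ k := hik
        simpa [localGenerators, this] using hy
      · intro y hy
        refine Subring.subset_closure (Set.mem_iUnion.2 ⟨k, ?_⟩)
        simpa [localGenerators] using hy
  have hmem := key (Finset.univ.filter (· ∉ S.frozen)) (by simp) ∅ (by simp)
  refine Subring.closure_le.2 (Set.iUnion_subset fun i => ?_) hmem
  by_cases hi : i ∈ S.frozen
  · rw [localGenerators, if_neg (by simpa using hi)]
    rintro _ (rfl | rfl)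
    · simpa [exchanged] using S.x_mem i
    · simpa [exchanged] using S.inv_x_mem hi
  · rw [localGenerators, if_pos (by simpa using hi)]
    rintro _ (rfl | rfl)
    · exact S.x_mem i
    · rw [← mutate_x_self]
      exact MutEquiv.x_mem (S.mutEquiv_mutate hi) i

/-- Freezing localizes the cluster algebra, if no arrows between mutable vertices remain. That the
localization is not larger is the nontrivial part: by the Laurent phenomenon, every cluster
variable of `S` is a Laurent polynomial in each cluster of the freezing. -/
theorem clusterAlgebra_freeze_eq (S : Seed F V) (W : Finset V)
    (h : (S.freeze W).MutablesEdgeless) :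
    (S.freeze W).clusterAlgebra = localizeAt S.clusterAlgebra (∏ j ∈ W, S.x j) := by
  classical
  apply le_antisymm
  · refine Subring.closure_le.2 (Set.union_subset ?_ ?_)
    · rintro _ ⟨T', hT', i, rfl⟩
      obtain ⟨T, hT, rfl⟩ := hT'.exists_of_freeze
      exact le_localizeAt _ _ (hT.x_mem i)
    · rintro _ ⟨i, hi | hi, rfl⟩
      · exact le_localizeAt _ _ (S.inv_x_mem hi)
      · change (S.x i)⁻¹ ∈ _
        have hi : i ∈ W := hi
        have : (S.x i)⁻¹ = (∏ j ∈ W, S.x j)⁻¹ * ∏ j ∈ W.erase i, S.x j := by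
          rw [← Finset.mul_prod_erase W _ hi, mul_inv, inv_mul_cancel_right₀]
          exact Finset.prod_ne_zero_iff.2 fun j _ => S.x_ne_zero j
        rw [this]
        exact mul_mem (inv_mem_localizeAt _ _)
          (le_localizeAt _ _ (prod_mem fun j _ => S.x_mem j))
  · refine Subring.closure_le.2 (Set.union_subset (fun f hf => ?_) ?_)
    · refine h.mem_clusterAlgebra fun T' hT' => ?_
      obtain ⟨T, hT, rfl⟩ := hT'.exists_of_freeze
      rw [← hT.clusterAlgebra_eq] at hf
      exact T.clusterAlgebra_le_laurent hf
    · rintro _ rfl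
      rw [← Finset.prod_inv_distrib]
      exact prod_mem fun j hj => (S.freeze W).inv_x_mem (Or.inr hj)

/-! ### Coprime cluster variables -/

/-- If the arrow `s → t` lies on no bi-infinite path of mutable vertices, then `x s` and `x t` are
coprime. A maximal ideal that contains the variables at both ends of an arrow `a → b` contains no
frozen variable, and by the exchange relations at `b` and at `a` it also contains the variables at
both ends of some arrow `b → c` and of some arrow `c' → a`; so it yields a bi-infinite path. -/
theorem isCoprime_of_not_path (S : Seed F V) {s t : V}
    (hst : 0 < S.quiver.arrows s t)
    (hpath : ¬ ∃ p : ℤ → V, (∀ i, p i ∉ S.frozen) ∧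
      (∀ i, 0 < S.quiver.arrows (p i) (p (i + 1))) ∧ p 0 = s ∧ p 1 = t) :
    IsCoprime (⟨S.x s, S.x_mem s⟩ : S.clusterAlgebra) ⟨S.x t, S.x_mem t⟩ := by
  set X : V → S.clusterAlgebra := fun i => ⟨S.x i, S.x_mem i⟩ with hX
  change IsCoprime (X s) (X t)
  by_contra hcop
  have hne : Ideal.span {X s, X t} ≠ ⊤ := by
    intro htop
    rw [Ideal.eq_top_iff_one, Ideal.mem_span_pair] at htop
    exact hcop htop
  obtain ⟨m, hm, hle⟩ := Ideal.exists_le_maximal _ hne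
  have hmp := hm.isPrime
  have hsm : X s ∈ m := hle (Ideal.subset_span (by simp))
  have htm : X t ∈ m := hle (Ideal.subset_span (by simp))
  have hmut : ∀ i, X i ∈ m → i ∉ S.frozen := by
    intro i hi hif
    refine hmp.ne_top (Ideal.eq_top_of_isUnit_mem _ hi ?_)
    refine IsUnit.of_mul_eq_one ⟨(S.x i)⁻¹, S.inv_x_mem hif⟩ (Subtype.ext ?_)
    exact mul_inv_cancel₀ (S.x_ne_zero i)
  have hex : ∀ k, X k ∈ m →
      ∏ i, X i ^ S.quiver.arrows i k + ∏ i, X i ^ S.quiver.arrows k i ∈ m := by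
    intro k hk
    have : X k * ⟨(S.mutate k).x k, MutEquiv.x_mem (S.mutEquiv_mutate (hmut k hk)) k⟩ =
        ∏ i, X i ^ S.quiver.arrows i k + ∏ i, X i ^ S.quiver.arrows k i := by
      apply Subtype.ext
      push_cast
      exact S.x_mul_mutate_x k
    rw [← this]
    exact m.mul_mem_right _ hk
  have hprod : ∀ (e : V → ℕ) (i : V), X i ∈ m → 0 < e i → ∏ i, X i ^ e i ∈ m := fun e i hi he =>
    Ideal.mem_of_dvd _ (Finset.dvd_prod_of_mem _ (Finset.mem_univ i)) (m.pow_mem_of_mem hi _ he)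
  have hprod' : ∀ e : V → ℕ, ∏ i, X i ^ e i ∈ m → ∃ i, X i ∈ m ∧ 0 < e i := by
    intro e he
    obtain ⟨i, -, hi⟩ := hmp.prod_mem_iff.1 he
    refine ⟨i, hmp.mem_of_pow_mem _ hi, Nat.pos_of_ne_zero fun h0 => ?_⟩
    rw [h0, pow_zero] at hi
    exact hmp.ne_top ((Ideal.eq_top_iff_one _).2 hi)
  -- the arrows between vertices with variables in `m`
  let A := {p : V × V // X p.1 ∈ m ∧ X p.2 ∈ m ∧ 0 < S.quiver.arrows p.1 p.2}
  have hnext : ∀ e : A, ∃ e' : A, e'.1.1 = e.1.2 := by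
    rintro ⟨⟨a, b⟩, ha, hb, hab⟩
    obtain ⟨c, hc, hbc⟩ := hprod' _ ((Ideal.add_mem_iff_right _ (hprod _ a ha hab)).1 (hex b hb))
    exact ⟨⟨(b, c), hb, hc, hbc⟩, rfl⟩
  have hprev : ∀ e : A, ∃ e' : A, e'.1.2 = e.1.1 := by
    rintro ⟨⟨a, b⟩, ha, hb, hab⟩
    obtain ⟨c, hc, hca⟩ := hprod' _ ((Ideal.add_mem_iff_left _ (hprod _ b hb hab)).1 (hex a ha))
    exact ⟨⟨(c, a), hc, ha, hca⟩, rfl⟩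
  choose next hnext using hnext
  choose prev hprev using hprev
  let e₀ : A := ⟨(s, t), hsm, htm, hst⟩
  let E : ℤ → A
    | Int.ofNat n => next^[n] e₀
    | Int.negSucc n => prev^[n + 1] e₀
  have hE : ∀ i, (E (i + 1)).1.1 = (E i).1.2 := by
    intro i
    rcases i with n | n
    · change (next^[n + 1] e₀).1.1 = _
      rw [Function.iterate_succ_apply', hnext]
    · have h2 : (E (Int.negSucc n)).1.2 = (prev^[n] e₀).1.1 := by
        change (prev^[n + 1] e₀).1.2 = _
        rw [Function.iterate_succ_apply', hprev]
      rw [h2]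
      cases n <;> rfl
  refine hpath ⟨fun i => (E i).1.1, fun i => hmut _ (E i).2.1, fun i => ?_, rfl, ?_⟩
  · change 0 < S.quiver.arrows (E i).1.1 (E (i + 1)).1.1
    rw [hE]
    exact (E i).2.2.2
  · exact hE 0

/-! ### Covers of Louise cluster algebras -/

/-- The monomials `z` in the variables of one cluster such that freezing these variables leaves no
arrows between mutable vertices. -/
def edgelessMonomials (S : Seed F V) : Set F :=
  {z | ∃ (T : Seed F V) (W : Finset V), S.MutEquiv T ∧ (T.freeze W).MutablesEdgeless ∧
    z = ∏ j ∈ W, T.x j}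

/-- The monomials `z` of `edgelessMonomials` generate the unit ideal of the cluster algebra, that
is, the localizations at them cover its spectrum. -/
def IsCovered (S : Seed F V) : Prop :=
  (1 : F) ∈ Submodule.span S.clusterAlgebra S.edgelessMonomials

theorem IsCovered.of_mutEquiv {S T : Seed F V} (h : S.MutEquiv T) (hT : T.IsCovered) :
    S.IsCovered := by
  unfold IsCovered at hT ⊢
  rw [h.clusterAlgebra_eq] at hT
  refine Submodule.span_mono ?_ hT
  rintro _ ⟨U, W, hU, hW, rfl⟩
  exact ⟨U, W, h.trans hU, hW, rfl⟩

/-- If the seed with `v` frozen is covered, then the ideal generated by `S.edgelessMonomials`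
contains a power of `x v`. -/
theorem IsCovered.exists_pow_mem {S : Seed F V} {v : V} (h : (S.freeze {v}).IsCovered) :
    ∃ n : ℕ, S.x v ^ n ∈ Submodule.span S.clusterAlgebra S.edgelessMonomials := by
  classical
  set I := Submodule.span S.clusterAlgebra S.edgelessMonomials with hI
  have hsmul : ∀ a ∈ S.clusterAlgebra, ∀ y ∈ I, a * y ∈ I := fun a ha y hy =>
    I.smul_mem ⟨a, ha⟩ hy
  have hA : ∀ a ∈ (S.freeze {v}).clusterAlgebra, ∃ n : ℕ, a * S.x v ^ n ∈ S.clusterAlgebra := by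
    intro a ha
    rw [← mem_localizeAt_iff (S.x_mem v) (S.x_ne_zero v)]
    refine Subring.closure_le.2 (Set.union_subset ?_ ?_) ha
    · rintro _ ⟨T', hT', i, rfl⟩
      obtain ⟨T, hT, rfl⟩ := hT'.exists_of_freeze
      exact le_localizeAt _ _ (hT.x_mem i)
    · rintro _ ⟨i, hi | rfl, rfl⟩
      · exact le_localizeAt _ _ (S.inv_x_mem hi)
      · exact inv_mem_localizeAt _ _
  suffices ∀ y ∈ Submodule.span (S.freeze {v}).clusterAlgebra (S.freeze {v}).edgelessMonomials,
      ∃ n : ℕ, S.x v ^ n * y ∈ I by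
    obtain ⟨n, hn⟩ := this 1 h
    exact ⟨n, by simpa using hn⟩
  intro y hy
  induction hy using Submodule.span_induction with
  | mem z hz =>
    obtain ⟨T', W, hT', hW, rfl⟩ := hz
    obtain ⟨T, hT, rfl, hTv⟩ := hT'.exists_of_freeze'
    have hTv : T.x v = S.x v := hTv v rfl
    have hz : ∏ j ∈ insert v W, T.x j ∈ I := by
      refine Submodule.subset_span ⟨T, insert v W, hT, ?_, rfl⟩
      have : T.freeze (insert v W : Finset V) = (T.freeze {v}).freeze W := by
        refine Seed.ext rfl ?_ rfl
        simp only [freeze, Finset.coe_insert, Set.union_assoc, Set.singleton_union]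
      rwa [this]
    refine ⟨1, ?_⟩
    change S.x v ^ 1 * ∏ j ∈ W, T.x j ∈ I
    by_cases hv : v ∈ W
    · rw [Finset.insert_eq_of_mem hv] at hz
      exact hsmul _ (pow_mem (S.x_mem v) 1) _ hz
    · rwa [Finset.prod_insert hv, hTv, ← pow_one (S.x v)] at hz
  | zero => exact ⟨0, by simp⟩
  | add a b _ _ ha hb =>
    obtain ⟨n, hn⟩ := ha
    obtain ⟨m, hm⟩ := hb
    refine ⟨n + m, ?_⟩
    have := add_mem (hsmul _ (pow_mem (S.x_mem v) m) _ hn) (hsmul _ (pow_mem (S.x_mem v) n) _ hm)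
    convert this using 1
    ring
  | smul a y _ hy =>
    obtain ⟨n, hn⟩ := hy
    obtain ⟨m, hm⟩ := hA a a.2
    refine ⟨n + m, ?_⟩
    have := hsmul _ hm _ hn
    convert this using 1
    change S.x v ^ (n + m) * ((a : F) * y) = _
    ring

/-- Induction on the construction of Louise quivers. The mutable quiver of `S` is identified with
`Q` by means of the injection `f`, since passing to an induced subquiver changes the type of
vertices. In the inductive step, powers of the coprime variables `x s` and `x t` lie in the ideal
that is to be the unit ideal. -/
theorem isCovered_of_isLouise {U : Type u} {Q : ClusterQuiver U} (hQ : Q.IsLouise) :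
    ∀ (S : Seed F V) (f : U → V), Function.Injective f → Set.range f = S.frozenᶜ →
      (∀ a b, S.quiver.arrows (f a) (f b) = Q.arrows a b) → S.IsCovered := by
  -- deleting the vertex `t` of `Q` corresponds to freezing the vertex `f t` of `S`
  have hfreeze : ∀ {U : Type u} (Q : ClusterQuiver U) (S : Seed F V) (f : U → V) (t : U),
      Function.Injective f → Set.range f = S.frozenᶜ →
      (∀ a b, S.quiver.arrows (f a) (f b) = Q.arrows a b) →
      (∀ (S : Seed F V) (f : ({t}ᶜ : Set U) → V), Function.Injective f →
        Set.range f = S.frozenᶜ → (∀ a b, S.quiver.arrows (f a) (f b) =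
        (Q.induce {t}ᶜ).arrows a b) → S.IsCovered) → (S.freeze {f t}).IsCovered := by
    intro U Q S f t hf hr ha ih
    refine ih (S.freeze {f t}) (fun a => f a) (hf.comp Subtype.val_injective) ?_
      fun a b => ha a b
    ext i
    have hi : i ∈ Set.range f ↔ i ∉ S.frozen := by rw [hr]; rfl
    simp only [freeze, Set.compl_union, Set.mem_inter_iff, Set.mem_compl_iff,
      Set.mem_singleton_iff, ← hi, Set.mem_range, Subtype.exists, exists_prop]
    constructor
    · rintro ⟨a, hat, rfl⟩
      exact ⟨⟨a, rfl⟩, fun h => hat (hf h)⟩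
    · rintro ⟨⟨a, rfl⟩, hat⟩
      exact ⟨a, fun h => hat (by rw [h]), rfl⟩
  induction hQ with
  | edgeless Q hQ =>
    intro S f hf hr ha
    refine Submodule.subset_span ⟨S, ∅, Relation.ReflTransGen.refl, ?_, by simp⟩
    intro a ha' b hb'
    have hmem : ∀ c, c ∉ (S.freeze ((∅ : Finset V) : Set V)).frozen → c ∈ Set.range f := by
      intro c hc
      rw [hr]
      exact fun h => hc (Or.inl h)
    obtain ⟨a, rfl⟩ := hmem a ha'
    obtain ⟨b, rfl⟩ := hmem b hb'
    exact (ha a b).trans (hQ a b)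
  | mutate Q k _ ih =>
    intro S f hf hr ha
    have hk : f k ∈ S.mutableVertices := by
      change f k ∈ S.frozenᶜ
      rw [← hr]
      exact ⟨k, rfl⟩
    refine IsCovered.of_mutEquiv (S.mutEquiv_mutate hk) (ih _ f hf hr fun a b => ?_)
    conv_rhs => rw [← Q.mutate_mutate k]
    change (S.quiver.mutate (f k)).arrows (f a) (f b) = ((Q.mutate k).mutate k).arrows a b
    by_cases hab : a = k ∨ b = k
    · have hab' : f a = f k ∨ f b = f k := by simpa [hf.eq_iff] using hab
      rw [ClusterQuiver.mutate, ClusterQuiver.mutate]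
      simp only [if_pos hab, if_pos hab', ha]
    · have hab' : ¬ (f a = f k ∨ f b = f k) := by simpa [hf.eq_iff] using hab
      rw [ClusterQuiver.mutate, ClusterQuiver.mutate]
      simp only [if_neg hab, if_neg hab', ha]
  | step Q s t hst hpath _ _ _ ih1 ih2 _ =>
    intro S f hf hr ha
    have hmem : ∀ a, f a ∉ S.frozen := fun a => by
      have : f a ∈ S.frozenᶜ := hr ▸ ⟨a, rfl⟩
      exact this
    have hcop := S.isCoprime_of_not_path (by rwa [ha]) (by
      rintro ⟨p, hp1, hp2, hp3, hp4⟩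
      have hp : ∀ i, ∃ a, f a = p i := fun i => by
        have : p i ∈ Set.range f := by rw [hr]; exact hp1 i
        exact this
      choose q hq using hp
      refine hpath ⟨q, fun i => ?_, 0, hf (by rw [hq, hp3]), hf (by rw [zero_add, hq, hp4])⟩
      rw [← ha, hq, hq]
      exact hp2 i)
    obtain ⟨n, hn⟩ := (hfreeze Q S f t hf hr ha ih1).exists_pow_mem
    obtain ⟨m, hm⟩ := (hfreeze Q S f s hf hr ha ih2).exists_pow_mem
    obtain ⟨a, b, hab⟩ := hcop.pow (m := m) (n := n)
    have := add_mem (Submodule.smul_mem _ a hm) (Submodule.smul_mem _ b hn)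
    unfold IsCovered
    convert this using 1
    exact (congrArg Subtype.val hab).symm

/-! ### From covers to local acyclicity -/

theorem IsCovered.isLocallyAcyclic {S : Seed F V} (h : S.IsCovered) : S.IsLocallyAcyclic := by
  obtain ⟨Z, hZ, h1⟩ := Submodule.mem_span_finite_of_mem_span h
  have hZ' : ∀ i, ((Z.equivFin.symm i : Z) : F) ∈ S.edgelessMonomials := fun i =>
    hZ (Z.equivFin.symm i).2
  choose T W hT hW hz using hZ'
  refine ⟨Z.card, T, W, hT, fun i =>
    ⟨?_, (T i).freeze (W i), Relation.ReflTransGen.refl, (hW i).isAcyclic⟩, ?_⟩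
  · rw [(T i).clusterAlgebra_freeze_eq (W i) (hW i), (hT i).clusterAlgebra_eq]
  have hmem : ∀ i, ∏ j ∈ W i, (T i).x j ∈ S.clusterAlgebra := fun i =>
    prod_mem fun j _ => (hT i).x_mem j
  refine Set.eq_univ_of_forall fun P => ?_
  by_contra hP
  rw [Set.mem_iUnion, not_exists] at hP
  have hP' : ∀ i, (⟨_, hmem i⟩ : S.clusterAlgebra) ∈ P.asIdeal := by
    intro i
    have := hP i
    rw [range_comap_localizeAt S.clusterAlgebra (hmem i)
      (Finset.prod_ne_zero_iff.2 fun j _ => (T i).x_ne_zero j)] at this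
    exact not_not.1 this
  have hle : Submodule.span S.clusterAlgebra (Z : Set F) ≤
      Submodule.map (Algebra.linearMap S.clusterAlgebra F) P.asIdeal := by
    refine Submodule.span_le.2 fun z hzZ => ?_
    have e := hz (Z.equivFin ⟨z, hzZ⟩)
    rw [Equiv.symm_apply_apply] at e
    exact ⟨_, hP' (Z.equivFin ⟨z, hzZ⟩), e.symm⟩
  obtain ⟨a, haP, ha⟩ := hle h1
  have : a = 1 := Subtype.ext ha
  rw [this] at haP
  exact P.isPrime.ne_top ((Ideal.eq_top_iff_one _).2 haP)

end Seed

end ClusterTheory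

theorem mainTheorem2 {F : Type*} [Field F] [CharZero F] {V : Type*} [Fintype V]
    (S : ClusterTheory.Seed F V) (hS : S.IsLouise) :
    S.IsLocallyAcyclic :=
  (ClusterTheory.Seed.isCovered_of_isLouise (hS S Relation.ReflTransGen.refl) S Subtype.val
    Subtype.val_injective Subtype.range_coe fun _ _ => rfl).isLocallyAcyclic
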